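/- Let $\mathcal A$ be a von Neumann algebra with a normal faithful tracial state $\tau$. For $V=V^*\in\mathcal A$, write $\tau(\cdot\,|\,V)$ for the $\tau$-preserving conditional expectation onto the von Neumann algebra generated by $V$ and the identity $\mathbb I$. For $a\in\mathbb R$ and $b\ge-1$ let $\mu_{a,b}$ be the free Meixner law, i.e. the compactly supported probability measure on $\mathbb R$ with Cauchy–Stieltjes transform $$\int_{\mathbb R}\frac{\mu_{a,b}(dy)}{z-y}=\frac{(1+2b)z+a-\sqrt{(z-a)^2-4(1+b)}}{2(bz^2+az+1)},\qquad \operatorname{Im} z>0,$$ where the analytic branch of the square root is the one for which the right-hand side has imaginary part $\le 0$ and is the transform of a probability measure (removable singularities being filled in). Let $\mathbb X,\mathbb Y\in\mathcal A$ be free, self-adjoint, non-degenerate (not multiples of $\mathbb I$) and centered, $\tau(\mathbb X)=\tau(\mathbb Y)=0$, with $\tau(\mathbb X^2+\mathbb Y^2)=1$. Let $\alpha,\beta>0$ with $\alpha+\beta=1$, let $a\in\mathbb R$ and $b\ge-1$, and if $b<0$ assume moreover that $b\ge\max\{-\alpha,-\beta\}$. Then the following are equivalent: (i) $\mathbb X/\sqrt\alpha$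 and $\mathbb Y/\sqrt\beta$ have the free Meixner laws $\mu_{a/\sqrt\alpha,\,b/\alpha}$ and $\mu_{a/\sqrt\beta,\,b/\beta}$, respectively; (ii) $\tau(\mathbb X\,|\,\mathbb X+\mathbb Y)=\alpha(\mathbb X+\mathbb Y)$ and $$\tau\big((\beta\mathbb X-\alpha\mathbb Y)(\mathbb X+\mathbb Y)(\beta\mathbb X-\alpha\mathbb Y)\,\big|\,\mathbb X+\mathbb Y\big)=\frac{\alpha\beta}{(b+1)^2}\Big(b^2(\mathbb X+\mathbb Y)^3+2ab(\mathbb X+\mathbb Y)^2+(b+a^2)(\mathbb X+\mathbb Y)+a\mathbb I\Big).$$ -/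

import Mathlib

namespace FreeMeixner

section OperatorAlgebra

variable {H : Type*} [NormedAddCommGroup H] [InnerProductSpace ℂ H] [CompleteSpace H]

/-- The ultraweak (σ-weak, weak-*) topology on the bounded operators of `H`: the coarsest topology
for which all functionals `T ↦ ∑ₙ ⟪ξₙ, T ηₙ⟫` with `∑ ‖ξₙ‖² < ∞`, `∑ ‖ηₙ‖² < ∞` (that is, the
elements of the predual of `B(H)`) are continuous. -/
@[reducible] noncomputable def ultraweakTopology (H : Type*) [NormedAddCommGroup H] [InnerProductSpace ℂ H] :
    TopologicalSpace (H →L[ℂ] H) :=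
  ⨅ p : {p : (ℕ → H) × (ℕ → H) //
      Summable (fun n => ‖p.1 n‖ ^ 2) ∧ Summable (fun n => ‖p.2 n‖ ^ 2)},
    TopologicalSpace.induced
      (fun T : H →L[ℂ] H => ∑' n, inner ℂ (p.1.1 n) (T (p.1.2 n))) inferInstance

open scoped ComplexOrder in
/-- `τ` is a normal faithful tracial state on the von Neumann algebra `𝒜`. Normality is continuity
for the weak-* topology of `𝒜`, the restriction of the ultraweak topology. -/
structure IsNormalFaithfulTracialState (𝒜 : VonNeumannAlgebra H)
    (τ : 𝒜.toStarSubalgebra →ₗ[ℂ] ℂ) : Prop where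
  map_one : τ 1 = 1
  trace : ∀ x y, τ (x * y) = τ (y * x)
  nonneg : ∀ x, 0 ≤ τ (x * star x)
  faithful : ∀ x, τ (x * star x) = 0 → x = 0
  normal : @Continuous _ _
    (TopologicalSpace.induced (Subtype.val : 𝒜.toStarSubalgebra → (H →L[ℂ] H))
      (ultraweakTopology H)) _ τ

/-- The von Neumann algebra generated by a set of operators: the intersection of all von Neumann
algebras on `H` that contain the set. (It contains the identity, as they all do.) -/
noncomputable def generatedBy (s : Set (H →L[ℂ] H)) : VonNeumannAlgebra H where
  toStarSubalgebra :=
    sInf {B | ∃ M : VonNeumannAlgebra H, s ⊆ (M : Set (H →L[ℂ] H)) ∧ M.toStarSubalgebra = B}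
  centralizer_centralizer' := by
    refine subset_antisymm ?_ Set.subset_centralizer_centralizer
    intro T hT
    change T ∈ sInf {B | ∃ M : VonNeumannAlgebra H,
      s ⊆ (M : Set (H →L[ℂ] H)) ∧ M.toStarSubalgebra = B}
    rw [StarSubalgebra.mem_sInf]
    rintro B ⟨M, hM, rfl⟩
    rw [VonNeumannAlgebra.mem_carrier, ← M.centralizer_centralizer]
    refine Set.centralizer_subset (Set.centralizer_subset ?_) hT
    intro U hU
    exact (StarSubalgebra.mem_sInf.1 hU) _ ⟨M, hM, rfl⟩

theorem mem_generatedBy {s : Set (H →L[ℂ] H)} {T : H →L[ℂ] H} :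
    T ∈ generatedBy s ↔
      ∀ M : VonNeumannAlgebra H, s ⊆ (M : Set (H →L[ℂ] H)) → T ∈ M := by
  change T ∈ sInf {B | ∃ M : VonNeumannAlgebra H,
      s ⊆ (M : Set (H →L[ℂ] H)) ∧ M.toStarSubalgebra = B} ↔ _
  rw [StarSubalgebra.mem_sInf]
  constructor
  · intro h M hM
    exact h _ ⟨M, hM, rfl⟩
  · rintro h B ⟨M, hM, rfl⟩
    exact h M hM

/-- `τ(U | V) = W`, where `τ(· | V)` is the `τ`-preserving conditional expectation of `𝒜` onto the
von Neumann algebra generated by `V` (and the identity): `W` belongs to that algebra and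
`τ(U Z) = τ(W Z)` for all `Z` in it. Faithfulness of `τ` makes such a `W` unique. -/
def IsCondExp {𝒜 : VonNeumannAlgebra H} (τ : 𝒜.toStarSubalgebra →ₗ[ℂ] ℂ)
    (U V W : 𝒜.toStarSubalgebra) : Prop :=
  (W : H →L[ℂ] H) ∈ generatedBy {(V : H →L[ℂ] H)} ∧
    ∀ Z : 𝒜.toStarSubalgebra, (Z : H →L[ℂ] H) ∈ generatedBy {(V : H →L[ℂ] H)} →
      τ (U * Z) = τ (W * Z)

end OperatorAlgebra

section NoncommutativeProbability

variable {A : Type*} [Ring A] [Algebra ℂ A]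

/-- Free independence of the variables `x i` with respect to `τ`: if `w₁, …, wₙ` (`n ≥ 1`) are
polynomials in `x i₁, …, x iₙ` respectively, neighbouring indices are different and every `wₖ` is
centered, then the product `w₁ ⋯ wₙ` is centered. (Equivalently, all mixed free cumulants of the
variables vanish.) -/
def FreelyIndependent {ι : Type*} (τ : A →ₗ[ℂ] ℂ) (x : ι → A) : Prop :=
  ∀ w : List (ι × Polynomial ℂ), w ≠ [] →
    w.IsChain (fun u v => u.1 ≠ v.1) →
    (∀ u ∈ w, τ (Polynomial.aeval (x u.1) u.2) = 0) →
    τ ((w.map fun u => Polynomial.aeval (x u.1) u.2).prod) = 0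

/-- A variable is non-degenerate if it is not a multiple of the identity. -/
def Nondegenerate (x : A) : Prop := ∀ c : ℂ, x ≠ algebraMap ℂ A c

/-- The Cauchy–Stieltjes transform of a measure on the real line. -/
noncomputable def cauchyTransform (μ : MeasureTheory.Measure ℝ) (z : ℂ) : ℂ :=
  ∫ y : ℝ, 1 / (z - (y : ℂ)) ∂μ

/-- A compactly supported probability measure on the real line. -/
def IsCompactlySupportedProbability (μ : MeasureTheory.Measure ℝ) : Prop :=
  MeasureTheory.IsProbabilityMeasure μ ∧ ∃ K : Set ℝ, IsCompact K ∧ μ Kᶜ = 0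

/-- `μ` is the free Meixner law `μ_{a,b}`: the compactly supported probability measure whose
Cauchy–Stieltjes transform on the upper half plane is
`((1 + 2b) z + a - √((z - a)² - 4 (1 + b))) / (2 (b z² + a z + 1))`
for an analytic branch `s` of the square root. The condition `Im G(z) ≤ 0` that selects the branch
is automatic here, because the left-hand side is the transform of a probability measure. At the
zeros of the denominator in the upper half plane the quotient has a removable singularity, and
these points are left out. -/
def IsFreeMeixnerLaw (a b : ℝ) (μ : MeasureTheory.Measure ℝ) : Prop :=
  IsCompactlySupportedProbability μ ∧
  ∃ s : ℂ → ℂ, DifferentiableOn ℂ s {z : ℂ | 0 < z.im} ∧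
    (∀ z : ℂ, 0 < z.im → s z ^ 2 = (z - (a : ℂ)) ^ 2 - 4 * (1 + (b : ℂ))) ∧
    ∀ z : ℂ, 0 < z.im → (b : ℂ) * z ^ 2 + (a : ℂ) * z + 1 ≠ 0 →
      cauchyTransform μ z =
        ((1 + 2 * (b : ℂ)) * z + (a : ℂ) - s z) / (2 * ((b : ℂ) * z ^ 2 + (a : ℂ) * z + 1))

/-- `μ` is the law of the variable `x` with respect to `τ`: the compactly supported probability
measure with the same moments. -/
def IsLawOf (τ : A →ₗ[ℂ] ℂ) (x : A) (μ : MeasureTheory.Measure ℝ) : Prop :=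
  IsCompactlySupportedProbability μ ∧ ∀ n : ℕ, τ (x ^ n) = ((∫ t : ℝ, t ^ n ∂μ : ℝ) : ℂ)

/-- The variable `x` has the free Meixner law `μ_{a,b}`. -/
def HasFreeMeixnerLaw (τ : A →ₗ[ℂ] ℂ) (x : A) (a b : ℝ) : Prop :=
  ∃ μ : MeasureTheory.Measure ℝ, IsFreeMeixnerLaw a b μ ∧ IsLawOf τ x μ

end NoncommutativeProbability

end FreeMeixner

/-! Both sides are translated into identities between formal power series satisfied by the
R-transforms of $\mathbb X$ and $\mathbb Y$. Write $r=uR(u)$ and $s=uS(u)$ for the R-transforms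
multiplied by the variable. Then $(1+r-u\mathbb X)^{-1}$ has expectation 1, and so does
$(1+s-u\mathbb Y)^{-1}$.

Laws: the Meixner formula for the Cauchy transform is a quadratic equation for the moment series
(`hasFreeMeixnerLaw_iff`). The substitution $u\mapsto u/(1+r)$ turns it into a quadratic equation
for the R-transform (`IsRTransform.quadratic_iff`). After rescaling, (i) reads $r=\alpha
u^2+aur+(b/\alpha)r^2$ together with the same equation for $s$ and $\beta$. Equivalently,
$r=\alpha\rho$ and $s=\beta\rho$ with $\rho=u^2+au\rho+b\rho^2$.

Conditional expectations: by normality and the double commutant theorem they may be tested on powers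
of $\mathbb X+\mathbb Y$ (`isCondExp_iff_pow`), hence on the formal resolvent of $\mathbb X+\mathbb
Y$. Freeness gives subordination (`FreelyIndependent.subordination`): against polynomials in
$\mathbb X$ alone, that resolvent may be replaced by the resolvent of $\mathbb X$. Traciality
reduces the cubic moment to words of this kind (`trace_cubic_identity`).

The linear regression then says $r=\alpha(r+s)$, and the cubic one is a cubic equation for
$\rho=r+s$. The cubic is the quadratic above times a nonzero series (`cubic_iff_quadratic`). -/

namespace FreeMeixner

open PowerSeries

/-! ### Formal resolvents over a noncommutative algebra. -/

section FormalSeries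

variable {A : Type*} [Ring A] [Algebra ℂ A]

/-- Scalar power series, as central elements of the algebra of power series over `A`. -/
noncomputable def scalarSeries (A : Type*) [Ring A] [Algebra ℂ A] : ℂ⟦X⟧ →+* A⟦X⟧ :=
  PowerSeries.map (algebraMap ℂ A)

/-- The coefficientwise extension of a linear functional to power series. -/
noncomputable def mapCoeff (L : A →ₗ[ℂ] ℂ) : A⟦X⟧ →ₗ[ℂ] ℂ⟦X⟧ where
  toFun f := PowerSeries.mk fun n => L (coeff n f)
  map_add' f g := by ext n; simp
  map_smul' c f := by ext n; simp

@[simp]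
theorem coeff_mapCoeff (L : A →ₗ[ℂ] ℂ) (f : A⟦X⟧) (n : ℕ) :
    coeff n (mapCoeff L f) = L (coeff n f) := by
  simp [mapCoeff]

theorem commute_scalarSeries (f : ℂ⟦X⟧) (x : A⟦X⟧) : Commute (scalarSeries A f) x := by
  ext n
  rw [coeff_mul, coeff_mul, ← Finset.Nat.sum_antidiagonal_swap]
  refine Finset.sum_congr rfl fun p _ => ?_
  simp [scalarSeries, Algebra.commutes]

@[simp]
theorem mapCoeff_scalarSeries_mul (L : A →ₗ[ℂ] ℂ) (f : ℂ⟦X⟧) (x : A⟦X⟧) :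
    mapCoeff L (scalarSeries A f * x) = f * mapCoeff L x := by
  ext n
  rw [coeff_mapCoeff, coeff_mul, coeff_mul, map_sum]
  refine Finset.sum_congr rfl fun p _ => ?_
  simp [scalarSeries, ← Algebra.smul_def]

@[simp]
theorem mapCoeff_X_mul (L : A →ₗ[ℂ] ℂ) (x : A⟦X⟧) :
    mapCoeff L (X * x) = X * mapCoeff L x := by
  have : (X : A⟦X⟧) = scalarSeries A X := by simp [scalarSeries]
  rw [this, mapCoeff_scalarSeries_mul]

@[simp]
theorem mapCoeff_C (L : A →ₗ[ℂ] ℂ) (x : A) : mapCoeff L (C x) = C (L x) := by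
  ext n
  by_cases h : n = 0 <;> simp [coeff_C, h]

theorem mapCoeff_comp_mulLeft (L : A →ₗ[ℂ] ℂ) (c : A) (f : A⟦X⟧) :
    mapCoeff (L ∘ₗ LinearMap.mulLeft ℂ c) f = mapCoeff L (C c * f) := by
  ext n
  simp

/-- The pencil `1 + r - u x` whose inverse, for a suitable scalar series `r`, is the resolvent of
`x`. -/
noncomputable def pencil (r : ℂ⟦X⟧) (x : A) : A⟦X⟧ := scalarSeries A (1 + r) - X * C x

/-- The formal resolvent `(1 + r - u x)⁻¹`. -/
noncomputable def resolvent (r : ℂ⟦X⟧) (x : A) : A⟦X⟧ := invOfUnit (pencil r x) 1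

variable {r : ℂ⟦X⟧}

theorem constantCoeff_pencil (hr : constantCoeff r = 0) (x : A) :
    constantCoeff (pencil r x) = ((1 : Aˣ) : A) := by
  have : constantCoeff (PowerSeries.map (algebraMap ℂ A) r) = 0 := by
    rw [← coeff_zero_eq_constantCoeff_apply, coeff_map, coeff_zero_eq_constantCoeff_apply, hr,
      map_zero]
  simp [pencil, scalarSeries, this]

theorem pencil_mul_resolvent (hr : constantCoeff r = 0) (x : A) :
    pencil r x * resolvent r x = 1 :=
  mul_invOfUnit _ _ (constantCoeff_pencil hr x)

theorem resolvent_mul_pencil (hr : constantCoeff r = 0) (x : A) :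
    resolvent r x * pencil r x = 1 :=
  invOfUnit_mul _ _ (constantCoeff_pencil hr x)

theorem constantCoeff_resolvent (hr : constantCoeff r = 0) (x : A) :
    constantCoeff (resolvent r x) = 1 := by
  have := congrArg constantCoeff (pencil_mul_resolvent hr x)
  rw [map_mul, constantCoeff_pencil hr, Units.val_one, one_mul, map_one] at this
  exact this

/-- The resolvent equation `u x (1 + r - u x)⁻¹ = (1 + r) (1 + r - u x)⁻¹ - 1`. -/
theorem X_mul_C_mul_resolvent (hr : constantCoeff r = 0) (x : A) :
    X * (C x * resolvent r x) = scalarSeries A (1 + r) * resolvent r x - 1 := by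
  have h := pencil_mul_resolvent hr x
  rw [pencil, sub_mul, mul_assoc] at h
  rw [← h]
  abel

theorem mapCoeff_mul_resolvent (hr : constantCoeff r = 0) (L : A →ₗ[ℂ] ℂ) (y x : A) :
    X * mapCoeff L (C (y * x) * resolvent r x) =
      (1 + r) * mapCoeff L (C y * resolvent r x) - C (L y) := by
  rw [← mapCoeff_X_mul, RingHom.map_mul, mul_assoc, ← mul_assoc, ← (commute_X (C y)).eq, mul_assoc,
    X_mul_C_mul_resolvent hr, mul_sub, mul_one, map_sub, mapCoeff_C, ← mul_assoc,
    ← (commute_scalarSeries _ _).eq, mul_assoc, mapCoeff_scalarSeries_mul]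

theorem eq_zero_of_forall_X_pow_dvd {f : ℂ⟦X⟧} (h : ∀ n, X ^ n ∣ f) : f = 0 := by
  ext n
  exact X_pow_dvd_iff.1 (h (n + 1)) n (Nat.lt_succ_self n)

/-- Iterating the recursion gives `t k = w ^ n * t (k + n)`, which is divisible by every power of
the variable. This is the uniqueness principle for the moment recursions below. -/
theorem eq_zero_of_eq_mul_succ {w : ℂ⟦X⟧} (hw : X ∣ w) {t : ℕ → ℂ⟦X⟧}
    (h : ∀ k, t k = w * t (k + 1)) (k : ℕ) : t k = 0 := by
  refine eq_zero_of_forall_X_pow_dvd fun n => ?_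
  induction n generalizing k with
  | zero => simp
  | succ n ih => rw [h k, pow_succ']; exact mul_dvd_mul hw (ih (k + 1))

theorem isUnit_one_add (hr : constantCoeff r = 0) : IsUnit (1 + r) := by
  rw [isUnit_iff_constantCoeff]
  simp [hr]

/-- A functional vanishes on the formal resolvent of `x` iff it vanishes on the powers of `x`. -/
theorem mapCoeff_resolvent_eq_zero_iff (hr : constantCoeff r = 0) (L : A →ₗ[ℂ] ℂ) (x : A) :
    mapCoeff L (resolvent r x) = 0 ↔ ∀ n, L (x ^ n) = 0 := by
  have key : ∀ k, X * mapCoeff L (C (x ^ (k + 1)) * resolvent r x) =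
      (1 + r) * mapCoeff L (C (x ^ k) * resolvent r x) - C (L (x ^ k)) := fun k => by
    rw [pow_succ]; exact mapCoeff_mul_resolvent hr L (x ^ k) x
  constructor
  · intro h
    -- The constant term of `key k` yields `L (x ^ k) = 0`; cancelling the variable then passes to
    -- `k + 1`. The moment is therefore recorded one step late, and nothing is claimed about it at
    -- `k = 0`.
    have main : ∀ k, mapCoeff L (C (x ^ k) * resolvent r x) = 0 ∧ (1 ≤ k → L (x ^ (k - 1)) = 0) := by
      intro k
      induction k with
      | zero => simpa using h
      | succ k ih =>
        have h1 := key k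
        rw [ih.1, mul_zero, zero_sub] at h1
        have h2 : L (x ^ k) = 0 := by
          have := congrArg constantCoeff h1
          simpa using this.symm
        rw [h2, map_zero, neg_zero] at h1
        exact ⟨(mul_eq_zero.1 h1).resolve_left X_ne_zero, fun _ => by simpa using h2⟩
    intro n
    simpa using (main (n + 1)).2 (by omega)
  · intro h
    obtain ⟨v, hv⟩ := (isUnit_one_add hr).exists_right_inv
    have := eq_zero_of_eq_mul_succ (w := v * X) (Dvd.intro_left v rfl)
      (t := fun k => mapCoeff L (C (x ^ k) * resolvent r x)) (fun k => by
        have h1 := key k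
        rw [h k, map_zero, sub_zero] at h1
        linear_combination v * (-h1) - mapCoeff L (C (x ^ k) * resolvent r x) * hv) 0
    simpa using this

theorem mapCoeff_C_mul_resolvent_eq_iff (hr : constantCoeff r = 0) (L : A →ₗ[ℂ] ℂ) (x y z : A) :
    mapCoeff L (C y * resolvent r x) = mapCoeff L (C z * resolvent r x) ↔
      ∀ n, L (y * x ^ n) = L (z * x ^ n) := by
  have := mapCoeff_resolvent_eq_zero_iff hr (L ∘ₗ LinearMap.mulLeft ℂ (y - z)) x
  rw [mapCoeff_comp_mulLeft, map_sub, sub_mul, map_sub, sub_eq_zero] at this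
  rw [this]
  simp [sub_mul, sub_eq_zero]

/-- A submodule that contains `g` and is stable under the coefficients of `f` contains the
coefficients of the solution of `v = g + f v`. -/
theorem coeff_mem_of_eq_add_mul {V : Submodule ℂ A} {v g f : A⟦X⟧} (hv : v = g + f * v)
    (hg : ∀ n, coeff n g ∈ V) (hf0 : coeff 0 f = 0)
    (hf : ∀ n, ∀ y ∈ V, coeff n f * y ∈ V) (n : ℕ) : coeff n v ∈ V := by
  induction n using Nat.strong_induction_on with
  | _ n ih =>
    rw [hv, map_add, coeff_mul]
    refine V.add_mem (hg n) (V.sum_mem fun p hp => ?_)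
    rcases Nat.eq_zero_or_pos p.1 with h | h
    · rw [h, hf0, zero_mul]; exact V.zero_mem
    · have := Finset.HasAntidiagonal.mem_antidiagonal.1 hp
      exact hf _ _ (ih _ (by omega))

theorem coeff_resolvent_mem (hr : constantCoeff r = 0) {B : Subalgebra ℂ A} {x : A} (hx : x ∈ B)
    (n : ℕ) : coeff n (resolvent r x) ∈ B := by
  refine coeff_mem_of_eq_add_mul (V := Subalgebra.toSubmodule B) (g := 1) (f := 1 - pencil r x)
    ?_ ?_ ?_ ?_ n
  · rw [sub_mul, pencil_mul_resolvent hr, one_mul]; abel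
  · intro n
    rw [coeff_one]
    split_ifs
    · exact B.one_mem
    · exact B.zero_mem
  · simp [constantCoeff_pencil hr x]
  · intro n y hy
    refine B.mul_mem ?_ hy
    rw [map_sub, pencil, map_sub, coeff_one]
    refine B.sub_mem ?_ (B.sub_mem ?_ ?_)
    · split_ifs
      · exact B.one_mem
      · exact B.zero_mem
    · simp only [scalarSeries, coeff_map]
      exact B.algebraMap_mem _
    · rcases n with _ | n
      · simp
      · rw [coeff_succ_X_mul, coeff_C]
        split_ifs
        · exact hx
        · exact B.zero_mem

end FormalSeries

/-! ### The R-transform and the quadratic equation of the free Meixner laws. -/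

section RTransform

variable {A : Type*} [Ring A] [Algebra ℂ A]

/-- `r` is `u R(u)`, where `R` is the `R`-transform of `x`: with `u = G(z)` one has
`(z - x)⁻¹ = u (1 + r - u x)⁻¹`, and the condition says that its expectation is `u`. -/
def IsRTransform (τ : A →ₗ[ℂ] ℂ) (x : A) (r : ℂ⟦X⟧) : Prop :=
  constantCoeff r = 0 ∧ mapCoeff τ (resolvent r x) = 1

/-- The generating function of the moments of `x`. -/
noncomputable def momentSeries (τ : A →ₗ[ℂ] ℂ) (x : A) : ℂ⟦X⟧ := PowerSeries.mk fun n => τ (x ^ n)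

/-- Since `w = u / (1 + r)`, the resolvent is `(1 + r)⁻¹ (1 - w x)⁻¹`, a geometric series in `w x`.
In the proof both sides satisfy `t k = τ (x ^ k) + w * t (k + 1)`, so their difference vanishes. -/
theorem subst_momentSeries {w r : ℂ⟦X⟧} (hr : constantCoeff r = 0) (hw : w * (1 + r) = X)
    (τ : A →ₗ[ℂ] ℂ) (x : A) :
    (momentSeries τ x).subst w = (1 + r) * mapCoeff τ (resolvent r x) := by
  have hXw : X ∣ w := by
    rw [X_dvd_iff]
    simpa [hr] using congrArg constantCoeff hw
  have hs : HasSubst w := HasSubst.of_constantCoeff_zero' (X_dvd_iff.1 hXw)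
  let φ : ℂ⟦X⟧ →ₐ[ℂ] ℂ⟦X⟧ := substAlgHom hs
  have hφ : ∀ f : ℂ⟦X⟧, f.subst w = φ f := fun f => by simp [φ, coe_substAlgHom]
  have hφX : φ X = w := substAlgHom_X hs
  let m : ℕ → ℂ⟦X⟧ := fun k => PowerSeries.mk fun n => τ (x ^ (k + n))
  have hm : ∀ k, m k = C (τ (x ^ k)) + X * m (k + 1) := by
    intro k
    ext n
    rcases n with _ | n
    · simp [m]
    · simp [m, coeff_succ_X_mul, add_assoc, add_comm 1 n]
  have hφC : ∀ c : ℂ, φ (C c) = C c := fun c => φ.commutes c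
  have h0 := eq_zero_of_eq_mul_succ hXw
    (t := fun k => φ (m k) - (1 + r) * mapCoeff τ (C (x ^ k) * resolvent r x)) (fun k => by
      have h1 := mapCoeff_mul_resolvent hr τ (x ^ k) x
      rw [← pow_succ] at h1
      rw [hm k, map_add, map_mul, hφX, hφC]
      linear_combination h1 + mapCoeff τ (C (x ^ (k + 1)) * resolvent r x) * hw) 0
  have h2 : m 0 = momentSeries τ x := by simp [m, momentSeries]
  rw [hφ, ← h2]
  simpa [sub_eq_zero] using h0

/-- With `M` the moment series and `w` the compositional inverse of `u M(u)`, the choice is `1 + r =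
M(w)`. Then `w (1 + r) = u`, and `subst_momentSeries` forces the resolvent to have expectation 1. -/
theorem exists_isRTransform (τ : A →ₗ[ℂ] ℂ) (hτ : τ 1 = 1) (x : A) : ∃ r, IsRTransform τ x r := by
  let P : ℂ⟦X⟧ := X * momentSeries τ x
  have hP0 : constantCoeff P = 0 := by simp [P]
  have hP1 : coeff 1 P = 1 := by
    simp [P, momentSeries, hτ]
  have hinv : Invertible (coeff 1 P) := by rw [hP1]; exact invertibleOne
  have hs : HasSubst P.substInv := HasSubst.substInv P
  let φ : ℂ⟦X⟧ →ₐ[ℂ] ℂ⟦X⟧ := substAlgHom hs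
  have hφ : ∀ f : ℂ⟦X⟧, f.subst P.substInv = φ f := fun f => by simp [φ, coe_substAlgHom]
  have hφX : φ X = P.substInv := substAlgHom_X hs
  have hw : P.substInv * φ (momentSeries τ x) = X := by
    rw [← hφX, ← map_mul, ← hφ]
    exact subst_substInv_right P hP0
  set p := φ (momentSeries τ x) with hp
  have hw' : P.substInv * (1 + (p - 1)) = X := by rw [add_sub_cancel, hw]
  have hp0 : constantCoeff (p - 1) = 0 := by
    have h1 := congrArg (coeff 1) hw
    have h3 : coeff 1 P.substInv = 1 := by
      rw [coeff_one_substInv]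
      exact invOf_eq_left_inv (by rw [hP1, one_mul])
    rw [coeff_mul, Finset.Nat.antidiagonal_succ] at h1
    simp [h3, constantCoeff_substInv] at h1
    simp [h1]
  refine ⟨p - 1, hp0, ?_⟩
  have h := subst_momentSeries hp0 hw' τ x
  rw [hφ, ← hp, add_sub_cancel] at h
  have hp' : p ≠ 0 := by
    rintro h0
    rw [h0, mul_zero] at hw
    exact X_ne_zero hw.symm
  exact mul_left_cancel₀ hp' (by rw [← h, mul_one])

theorem subst_injective {w : ℂ⟦X⟧} (h0 : constantCoeff w = 0) (h1 : IsUnit (coeff 1 w))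
    {f : ℂ⟦X⟧} (hf : f.subst w = 0) : f = 0 := by
  have hs : HasSubst w := HasSubst.of_constantCoeff_zero' h0
  have hs' := HasSubst.substInvOfIsUnit w h1
  have := subst_comp_subst_apply hs hs' f
  rw [hf, subst_substInvOfIsUnit_right w h0, X_subst] at this
  rw [← this, ← coe_substAlgHom hs', map_zero]

/-- The free Meixner equation for the moment generating function is equivalent to a quadratic
equation for the `R`-transform. -/
theorem IsRTransform.quadratic_iff {τ : A →ₗ[ℂ] ℂ} {x : A} {r : ℂ⟦X⟧} (h : IsRTransform τ x r)
    (a b c : ℂ) :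
    momentSeries τ x ^ 2 * (C c * X ^ 2 + C a * X + C b)
        - momentSeries τ x * (C a * X + 1 + 2 * C b) + (1 + C b) = 0 ↔
      r = C c * X ^ 2 + C a * X * r + C b * r ^ 2 := by
  obtain ⟨v, hv⟩ := (isUnit_one_add h.1).exists_right_inv
  have hv0 : constantCoeff v = 1 := by simpa [h.1] using congrArg constantCoeff hv
  set w := X * v with hwdef
  have hw : w * (1 + r) = X := by rw [hwdef]; linear_combination X * hv
  have hw0 : constantCoeff w = 0 := by simp [hwdef]
  have hw1 : IsUnit (coeff 1 w) := by simp [hwdef, hv0]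
  have hs : HasSubst w := HasSubst.of_constantCoeff_zero' hw0
  have hM := subst_momentSeries h.1 hw τ x
  rw [h.2, mul_one] at hM
  let φ : ℂ⟦X⟧ →ₐ[ℂ] ℂ⟦X⟧ := substAlgHom hs
  have hφ : ∀ f : ℂ⟦X⟧, f.subst w = φ f := fun f => by simp [φ, coe_substAlgHom]
  have hφX : φ X = w := substAlgHom_X hs
  have hφC : ∀ c : ℂ, φ (C c) = C c := fun c => φ.commutes c
  rw [hφ] at hM
  have key : φ (momentSeries τ x ^ 2 * (C c * X ^ 2 + C a * X + C b)
        - momentSeries τ x * (C a * X + 1 + 2 * C b) + (1 + C b)) =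
      C c * X ^ 2 + C a * X * r + C b * r ^ 2 - r := by
    -- Under the substitution the moment series becomes `1 + r` and the variable becomes `w`; every
    -- product `w (1 + r)` collapses to the variable.
    simp only [map_add, map_sub, map_mul, map_pow, hM, hφX, hφC, map_one, map_ofNat]
    linear_combination (C c * (w * (1 + r) + X) + C a * (1 + r) - C a) * hw
  constructor
  · intro h0
    rw [h0, map_zero] at key
    linear_combination key
  · intro h0
    refine subst_injective hw0 hw1 ?_
    rw [hφ, key]
    linear_combination -h0

/-- The difference of the two equations is `r - s` times a series with constant term 1. -/
theorem eq_of_quadratic {a b : ℂ} {r s : ℂ⟦X⟧} (hr0 : constantCoeff r = 0)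
    (hs0 : constantCoeff s = 0) (hr : r = X ^ 2 + C a * X * r + C b * r ^ 2)
    (hs : s = X ^ 2 + C a * X * s + C b * s ^ 2) : r = s := by
  have h : (r - s) * (1 - C a * X - C b * (r + s)) = 0 := by linear_combination hr - hs
  refine sub_eq_zero.1 ((mul_eq_zero.1 h).resolve_right fun h0 => ?_)
  simpa [hr0, hs0] using congrArg constantCoeff h0

/-- This accounts for the parameter `b / c`: a summand carrying the fraction `c` of the R-transform
of the sum satisfies the equation with variance `c` exactly when the sum satisfies the normalized
one. -/
theorem quadratic_scale_iff {c : ℂ} (hc : c ≠ 0) (a b : ℂ) (r : ℂ⟦X⟧) :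
    C c * r = C c * X ^ 2 + C a * X * (C c * r) + C (b / c) * (C c * r) ^ 2 ↔
      r = X ^ 2 + C a * X * r + C b * r ^ 2 := by
  have hC : (C c : ℂ⟦X⟧) ≠ 0 := by rwa [Ne, map_eq_zero_iff C C_injective]
  have hb : (C (b / c) : ℂ⟦X⟧) * C c = C b := by rw [← map_mul, div_mul_cancel₀ _ hc]
  rw [← mul_right_inj' hC (b := r)]
  rw [show C c * X ^ 2 + C a * X * (C c * r) + C (b / c) * (C c * r) ^ 2 =
    C c * (X ^ 2 + C a * X * r + C b * r ^ 2) by linear_combination C c * r ^ 2 * hb]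

end RTransform

/-! ### Alternating products and subordination for free variables. -/

section Freeness

variable {A : Type*} [Ring A] [Algebra ℂ A] {ι : Type*}

/-- The span of the alternating products of centered polynomials in the variables `x i` whose first
factor is a polynomial in `x i`. -/
def alternatingSpan (τ : A →ₗ[ℂ] ℂ) (x : ι → A) (i : ι) : Submodule ℂ A :=
  Submodule.span ℂ {y | ∃ w : List (ι × Polynomial ℂ), w.head?.map Prod.fst = some i ∧
    w.IsChain (fun u v => u.1 ≠ v.1) ∧ (∀ u ∈ w, τ (Polynomial.aeval (x u.1) u.2) = 0) ∧
    y = (w.map fun u => Polynomial.aeval (x u.1) u.2).prod}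

variable {τ : A →ₗ[ℂ] ℂ} {x : ι → A}

theorem mem_alternatingSpan {i : ι} {c : A} (hc : c ∈ (Polynomial.aeval (R := ℂ) (x i)).range)
    (h0 : τ c = 0) : c ∈ alternatingSpan τ x i := by
  obtain ⟨p, rfl⟩ := hc
  exact Submodule.subset_span ⟨[(i, p)], by simp, by simp, by simpa using h0, by simp⟩

theorem mul_mem_alternatingSpan {i j : ι} (hij : i ≠ j) {c v : A}
    (hc : c ∈ (Polynomial.aeval (R := ℂ) (x i)).range) (h0 : τ c = 0)
    (hv : v ∈ alternatingSpan τ x j) : c * v ∈ alternatingSpan τ x i := by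
  obtain ⟨p, rfl⟩ := hc
  induction hv using Submodule.span_induction with
  | mem v h =>
    obtain ⟨w, h1, h2, h3, rfl⟩ := h
    refine Submodule.subset_span ⟨(i, p) :: w, by simp, ?_, ?_, by simp⟩
    · rw [List.isChain_cons]
      refine ⟨fun u hu => ?_, h2⟩
      rw [Option.mem_def] at hu
      rw [hu] at h1
      simp only [Option.map_some, Option.some.injEq] at h1
      rw [h1]
      exact hij
    · rintro u hu
      rcases List.mem_cons.1 hu with rfl | hu
      · exact h0
      · exact h3 u hu
  | zero => rw [mul_zero]; exact Submodule.zero_mem _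
  | add v w _ _ h1 h2 => rw [mul_add]; exact Submodule.add_mem _ h1 h2
  | smul k v _ h => rw [mul_smul_comm]; exact Submodule.smul_mem _ _ h

theorem FreelyIndependent.eq_zero_of_mem (h : FreelyIndependent τ x) {i : ι} {v : A}
    (hv : v ∈ alternatingSpan τ x i) : τ v = 0 := by
  induction hv using Submodule.span_induction with
  | mem v hv =>
    obtain ⟨w, h1, h2, h3, rfl⟩ := hv
    refine h w ?_ h2 h3
    rintro rfl
    simp at h1
  | zero => exact map_zero _
  | add v w _ _ h1 h2 => rw [map_add, h1, h2, add_zero]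
  | smul k v _ h => rw [map_smul, h, smul_zero]

/-- Split `c` into its expectation and a centered part: the centered part prolongs the alternating
products, and the scalar leaves them unchanged. -/
theorem FreelyIndependent.mul_eq_zero (h : FreelyIndependent τ x) (hτ : τ 1 = 1) {i j : ι}
    (hij : i ≠ j) {c v : A} (hc : c ∈ (Polynomial.aeval (R := ℂ) (x i)).range)
    (hv : v ∈ alternatingSpan τ x j) : τ (c * v) = 0 := by
  have h1 : τ ((c - algebraMap ℂ A (τ c)) * v) = 0 := by
    refine h.eq_zero_of_mem (mul_mem_alternatingSpan hij (Subalgebra.sub_mem _ hc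
      (Subalgebra.algebraMap_mem _ _)) ?_ hv)
    rw [map_sub, Algebra.algebraMap_eq_smul_one, map_smul, hτ, smul_eq_mul, mul_one, sub_self]
  rw [sub_mul, map_sub, ← Algebra.smul_def, map_smul, h.eq_zero_of_mem hv, smul_zero,
    sub_zero] at h1
  exact h1

/-- Subordination: the resolvent of the sum of two free variables `x i`, `x j` is projected onto the
algebra generated by `x i` to the resolvent of `x i` (in the normalization of `resolvent`). -/
theorem FreelyIndependent.subordination (h : FreelyIndependent τ x) (hτ : τ 1 = 1) {i j : ι}
    (hij : i ≠ j) {r s : ℂ⟦X⟧} (hr : IsRTransform τ (x i) r) (hs : IsRTransform τ (x j) s) {c : A}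
    (hc : c ∈ (Polynomial.aeval (R := ℂ) (x i)).range) :
    mapCoeff τ (C c * resolvent (r + s) (x i + x j)) = mapCoeff τ (C c * resolvent r (x i)) := by
  have hrs : constantCoeff (r + s) = 0 := by rw [map_add, hr.1, hs.1, add_zero]
  -- Additivity of the R-transform enters here: the pencils add up to the constant 1.
  have hpen : pencil (r + s) (x i + x j) = pencil r (x i) + pencil s (x j) - 1 := by
    simp only [pencil, map_add, map_one, mul_add]
    abel
  have hxmem : ∀ k, x k ∈ (Polynomial.aeval (R := ℂ) (x k)).range := fun k =>
    ⟨Polynomial.X, by simp⟩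
  have hcenter : ∀ {k : ι} {q : ℂ⟦X⟧}, IsRTransform τ (x k) q → ∀ n,
      coeff n (resolvent q (x k) - 1) ∈ (Polynomial.aeval (R := ℂ) (x k)).range ∧
        τ (coeff n (resolvent q (x k) - 1)) = 0 := by
    intro k q hq n
    constructor
    · rw [map_sub, coeff_one]
      refine Subalgebra.sub_mem _ (coeff_resolvent_mem hq.1 (hxmem k) n) ?_
      split_ifs
      · exact Subalgebra.one_mem _
      · exact Subalgebra.zero_mem _
    · rw [← coeff_mapCoeff, map_sub, hq.2, ← map_one (C (R := A)), mapCoeff_C, hτ, map_one, sub_self,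
        map_zero]
  have hpd := pencil_mul_resolvent hr.1 (x i)
  have hdp := resolvent_mul_pencil hr.1 (x i)
  have hpd' := pencil_mul_resolvent hs.1 (x j)
  have hdp' := resolvent_mul_pencil hs.1 (x j)
  have hPE := pencil_mul_resolvent hrs (x i + x j)
  have hd0 := constantCoeff_resolvent hr.1 (x i)
  have hd0' := constantCoeff_resolvent hs.1 (x j)
  have hci := hcenter hr
  have hcj := hcenter hs
  have hdi : ∀ n, coeff n (resolvent r (x i)) ∈ (Polynomial.aeval (R := ℂ) (x i)).range :=
    coeff_resolvent_mem hr.1 (hxmem i)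
  rw [hpen] at hPE
  generalize resolvent (r + s) (x i + x j) = E at *
  generalize resolvent r (x i) = d at *
  generalize resolvent s (x j) = d' at *
  generalize pencil r (x i) = p at *
  generalize pencil s (x j) = p' at *
  -- The error of subordination is `E - d = d * v`. It suffices that the coefficients of `v` are
  -- combinations of alternating products starting in `x j`, since `c * d` has coefficients in the
  -- algebra of `x i`.
  set v := p * E - 1 with hvdef
  have hE : E = d + d * v := by
    rw [hvdef, mul_sub, ← mul_assoc, hdp]; simp
  -- This fixed-point equation comes from `d' (p + p' - 1) d = 1 - (d' - 1)(d - 1)`. The factors `d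
  -- - 1` and `d' - 1` are centered with zero constant term, so it generates `v` degree by degree
  -- from alternating products.
  have hv : v = ((d' - 1) + (d' - 1) * (d - 1)) + (d' - 1) * (d - 1) * v := by
    have h1 : d' * (p + p' - 1) * d = 1 - (d' - 1) * (d - 1) := by
      have : d' * (p + p' - 1) * d = d' * (p * d) + (d' * p') * d - d' * d := by noncomm_ring
      rw [this, hpd, hdp']
      noncomm_ring
    have h2 : (1 - (d' - 1) * (d - 1)) * (p * E) = d' := by
      rw [← h1, mul_assoc, ← mul_assoc d, hdp, one_mul, mul_assoc, hPE, mul_one]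
    have h3 : p * E = v + 1 := by rw [hvdef]; abel
    rw [h3] at h2
    have h4 : v = d' - 1 + (d' - 1) * (d - 1) * (v + 1) := by
      rw [← sub_eq_zero, ← sub_eq_zero.2 h2]
      noncomm_ring
    rw [mul_add, mul_one] at h4
    nth_rw 1 [h4]
    abel
  have hvmem : ∀ n, coeff n v ∈ alternatingSpan τ x j := by
    refine coeff_mem_of_eq_add_mul hv (fun n => ?_) ?_ (fun n y hy => ?_)
    · rw [map_add, coeff_mul]
      refine Submodule.add_mem _ (mem_alternatingSpan (hcj n).1 (hcj n).2)
        (Submodule.sum_mem _ fun q _ => ?_)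
      exact mul_mem_alternatingSpan hij.symm (hcj _).1 (hcj _).2
        (mem_alternatingSpan (hci _).1 (hci _).2)
    · simp [hd0, hd0']
    · rw [coeff_mul, Finset.sum_mul]
      refine Submodule.sum_mem _ fun q _ => ?_
      rw [mul_assoc]
      exact mul_mem_alternatingSpan hij.symm (hcj _).1 (hcj _).2
        (mul_mem_alternatingSpan hij (hci _).1 (hci _).2 hy)
  rw [hE, mul_add, map_add, add_eq_left, ← mul_assoc]
  ext n
  rw [coeff_mapCoeff, coeff_mul, map_sum, map_zero]
  refine Finset.sum_eq_zero fun q _ => ?_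
  refine h.mul_eq_zero hτ hij ?_ (hvmem _)
  rw [coeff_C_mul]
  exact Subalgebra.mul_mem _ hc (hdi _)

end Freeness

/-! ### Low moments against the resolvent, in terms of the R-transform. -/

section Recursion

variable {A : Type*} [Ring A] [Algebra ℂ A] {τ : A →ₗ[ℂ] ℂ} {x : A} {r : ℂ⟦X⟧}

theorem IsRTransform.mapCoeff_one (h : IsRTransform τ x r) (hτ : τ 1 = 1) :
    X * mapCoeff τ (C x * resolvent r x) = r := by
  have := mapCoeff_mul_resolvent h.1 τ 1 x
  rw [one_mul, map_one, one_mul, h.2, hτ, map_one] at this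
  rw [this]
  ring

theorem IsRTransform.mapCoeff_two (h : IsRTransform τ x r) (hx : τ x = 0) (hτ : τ 1 = 1) :
    X ^ 2 * mapCoeff τ (C (x ^ 2) * resolvent r x) = (1 + r) * r := by
  have := mapCoeff_mul_resolvent h.1 τ x x
  rw [← pow_two, hx, map_zero, sub_zero] at this
  linear_combination X * this + (1 + r) * h.mapCoeff_one hτ

theorem IsRTransform.mapCoeff_three (h : IsRTransform τ x r) (hx : τ x = 0) (hτ : τ 1 = 1) :
    X ^ 3 * mapCoeff τ (C (x ^ 3) * resolvent r x) =
      (1 + r) ^ 2 * r - C (τ (x ^ 2)) * X ^ 2 := by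
  have := mapCoeff_mul_resolvent h.1 τ (x ^ 2) x
  rw [← pow_succ] at this
  linear_combination X ^ 2 * this + (1 + r) * h.mapCoeff_two hx hτ

/-- The second free cumulant of a centered variable is its variance. It supplies the normalization
`coeff 2 ρ = 1` needed in `cubic_iff_quadratic`. -/
theorem IsRTransform.coeff_two (h : IsRTransform τ x r) (hx : τ x = 0) (hτ : τ 1 = 1) :
    coeff 2 r = τ (x ^ 2) := by
  obtain ⟨q, hq⟩ : X ∣ mapCoeff τ (C x * resolvent r x) := by
    rw [X_dvd_iff, ← coeff_zero_eq_constantCoeff_apply]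
    simp [constantCoeff_resolvent h.1, hx]
  have hr : r = q * X ^ 2 := by
    rw [← h.mapCoeff_one hτ, hq]; ring
  have h2 := congrArg (coeff (0 + 2)) (h.mapCoeff_two hx hτ)
  rw [mul_comm, coeff_mul_X_pow, show (1 + r) * r = ((1 + r) * q) * X ^ 2 by rw [hr]; ring,
    coeff_mul_X_pow] at h2
  have h3 : coeff (0 + 2) r = constantCoeff q := by
    rw [hr, coeff_mul_X_pow, coeff_zero_eq_constantCoeff_apply]
  rw [zero_add] at h3
  rw [h3]
  simp [constantCoeff_resolvent h.1, h.1] at h2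
  exact h2.symm

end Recursion

/-! ### The regression conditions as equations for the R-transforms. -/

section Regression

/-- The cubic factors as the quadratic times `1 + 2b + bρ + aX`. That factor is nonzero because its
coefficients of degree 0 and 2 are `1 + 2b` and `b`, which cannot both vanish. -/
theorem cubic_iff_quadratic {ρ : ℂ⟦X⟧} (h0 : constantCoeff ρ = 0) (h2 : coeff 2 ρ = 1)
    (a b : ℂ) :
    C ((b + 1) ^ 2) * (ρ - X ^ 2) =
      C b ^ 2 * ((1 + ρ) ^ 2 * ρ - X ^ 2) + 2 * C a * C b * X * ((1 + ρ) * ρ) +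
        (C b + C a ^ 2) * X ^ 2 * ρ + C a * X ^ 3 ↔
      ρ = X ^ 2 + C a * X * ρ + C b * ρ ^ 2 := by
  have hne : 1 + 2 * C b + C b * ρ + C a * X ≠ 0 := by
    intro h
    have c0 := congrArg constantCoeff h
    have c2 := congrArg (coeff 2) h
    have e : (1 + 2 * C b + C b * ρ + C a * X : ℂ⟦X⟧) = C (1 + 2 * b) + C b * ρ + C a * X := by
      rw [map_add, map_mul, map_one, map_ofNat]
    rw [e] at c2
    simp only [map_add, coeff_C_mul, h2, coeff_C, coeff_X] at c2
    simp [h0] at c0 c2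
    simp [c2] at c0
  rw [← sub_eq_zero, ← sub_eq_zero (a := ρ)]
  rw [show C ((b + 1) ^ 2) * (ρ - X ^ 2) -
      (C b ^ 2 * ((1 + ρ) ^ 2 * ρ - X ^ 2) + 2 * C a * C b * X * ((1 + ρ) * ρ) +
        (C b + C a ^ 2) * X ^ 2 * ρ + C a * X ^ 3) =
      (ρ - (X ^ 2 + C a * X * ρ + C b * ρ ^ 2)) * (1 + 2 * C b + C b * ρ + C a * X) by
    simp only [map_add, map_pow, map_one]; ring]
  simp [hne]

variable {A : Type*} [Ring A] [Algebra ℂ A] {τ : A →ₗ[ℂ] ℂ}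

/-- The sandwiched product mixes `x` and `y`, whereas subordination handles only a polynomial in one
of them times a power of `x + y`. Writing `s = x + y`, one has `x s x = x³ + x y x`, and expanding
`x = s - y` in `x y x` leaves powers of `y` flanked by `s`. Cyclicity and commutation of `g` with
`s` gather the powers of `s` on one side. -/
theorem trace_cubic_identity (htr : ∀ x y, τ (x * y) = τ (y * x)) (x y g : A) (α : ℂ)
    (hg : Commute (x + y) g) :
    τ ((x - α • (x + y)) * (x + y) * (x - α • (x + y)) * g) =
      τ ((x ^ 3 + y ^ 3 - (2 : ℂ) • (y ^ 2 * (x + y)) + y * (x + y) ^ 2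
        - (2 * α) • (x * (x + y) ^ 2) + α ^ 2 • (x + y) ^ 3) * g) := by
  obtain ⟨s, hs⟩ : ∃ s, s = x + y := ⟨_, rfl⟩
  have hx : x = s - y := by rw [hs]; abel
  rw [← hs] at hg ⊢
  have e0 : (x - α • s) * s * (x - α • s) * g =
      x * s * x * g - α • (x * s * s * g) - α • (s * s * x * g) + α ^ 2 • (s ^ 3 * g) := by
    simp only [sub_mul, mul_sub, smul_mul_assoc, mul_smul_comm, smul_sub, smul_smul, pow_succ,
      pow_zero, one_mul, mul_assoc]
    abel
  have e1 : τ (s * s * x * g) = τ (x * s ^ 2 * g) := by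
    rw [mul_assoc, htr, mul_assoc x g, pow_two, mul_assoc x, ← (hg.mul_left hg).eq]
  have e2 : x * s * x * g = x ^ 3 * g + x * y * x * g := by
    rw [hs]; noncomm_ring
  have e3 : x * y * x * g = s * y * s * g - s * y ^ 2 * g - y ^ 2 * s * g + y ^ 3 * g := by
    rw [hx]; noncomm_ring
  have e4 : τ (s * y * s * g) = τ (y * s ^ 2 * g) := by
    rw [mul_assoc, mul_assoc, htr, ← mul_assoc y, mul_assoc (y * s), ← hg.eq]
    simp only [pow_two, mul_assoc]
  have e5 : τ (s * y ^ 2 * g) = τ (y ^ 2 * s * g) := by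
    rw [mul_assoc, htr, mul_assoc, ← hg.eq, mul_assoc]
  have e6 : x * s * s * g = x * s ^ 2 * g := by rw [pow_two, mul_assoc x s s]
  rw [e0, e6]
  simp only [map_add, map_sub, map_smul, e1, e2, e3, e4, e5, add_mul, sub_mul, smul_mul_assoc,
    smul_eq_mul]
  ring

/-- The linear regression and the cubic conditional moment of two free variables determine, and are
determined by, their `R`-transforms. -/
theorem regression_iff_quadratic (hτ : τ 1 = 1) (htr : ∀ x y, τ (x * y) = τ (y * x)) {x y : A}
    (hfree : FreelyIndependent τ ![x, y]) (hx0 : τ x = 0) (hy0 : τ y = 0)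
    (hxy : τ (x ^ 2 + y ^ 2) = 1) {α β a b : ℂ} (hα : α ≠ 0) (hβ : β ≠ 0) (hαβ : α + β = 1)
    (hb : b + 1 ≠ 0) {r s : ℂ⟦X⟧} (hr : IsRTransform τ x r) (hs : IsRTransform τ y s) :
    (r = C α * X ^ 2 + C a * X * r + C (b / α) * r ^ 2 ∧
      s = C β * X ^ 2 + C a * X * s + C (b / β) * s ^ 2) ↔
    (∀ n, τ (x * (x + y) ^ n) = τ ((α • (x + y)) * (x + y) ^ n)) ∧
      ∀ n, τ (((β • x - α • y) * (x + y) * (β • x - α • y)) * (x + y) ^ n) =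
        τ (((α * β / (b + 1) ^ 2) • (b ^ 2 • (x + y) ^ 3 + (2 * b * a) • (x + y) ^ 2 +
          (b + a ^ 2) • (x + y) + a • (1 : A))) * (x + y) ^ n) := by
  have hz : β • x - α • y = x - α • (x + y) := by
    rw [eq_sub_of_add_eq' hαβ]
    module
  have hrs : constantCoeff (r + s) = 0 := by rw [map_add, hr.1, hs.1, add_zero]
  -- Only powers of a single variable are moved to its own resolvent; factors of `x + y` are handled
  -- by the resolvent equation of the sum.
  have subx : ∀ k, mapCoeff τ (C (x ^ k) * resolvent (r + s) (x + y)) =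
      mapCoeff τ (C (x ^ k) * resolvent r x) := fun k =>
    hfree.subordination hτ (i := 0) (j := 1) (by decide) (r := r) (s := s) hr hs
      ⟨Polynomial.X ^ k, by simp⟩
  have suby : ∀ k, mapCoeff τ (C (y ^ k) * resolvent (r + s) (x + y)) =
      mapCoeff τ (C (y ^ k) * resolvent s y) := fun k => by
    rw [add_comm r, add_comm x]
    exact hfree.subordination hτ (i := 1) (j := 0) (by decide) (r := s) (s := r) hs hr
      ⟨Polynomial.X ^ k, by simp⟩
  have hR : IsRTransform τ (x + y) (r + s) :=
    ⟨hrs, by simpa using (subx 0).trans (by simpa using hr.2)⟩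
  have hS0 : τ (x + y) = 0 := by rw [map_add, hx0, hy0, add_zero]
  have hxy0 : τ (x * y) = 0 := by
    have := hfree [(0, Polynomial.X), (1, Polynomial.X)] (by simp) (by simp) (by simp [hx0, hy0])
    simpa using this
  have hS2 : τ ((x + y) ^ 2) = 1 := by
    have : (x + y) ^ 2 = (x ^ 2 + y ^ 2) + (x * y + y * x) := by noncomm_ring
    rw [this, map_add, hxy, map_add, htr y x, hxy0]
    ring
  have hxS : τ (x * (x + y)) = τ (x ^ 2) := by
    rw [mul_add, map_add, hxy0, pow_two, add_zero]
  have hyS : τ (y * (x + y)) = τ (y ^ 2) := by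
    rw [mul_add, map_add, htr y x, hxy0, pow_two, zero_add]
  have x1 := hr.mapCoeff_one hτ
  have x3 := hr.mapCoeff_three hx0 hτ
  have y1 := hs.mapCoeff_one hτ
  have y2 := hs.mapCoeff_two hy0 hτ
  have y3 := hs.mapCoeff_three hy0 hτ
  have s1 := hR.mapCoeff_one hτ
  have s2 := hR.mapCoeff_two hS0 hτ
  have s3 := hR.mapCoeff_three hS0 hτ
  have subx1 := subx 1
  have suby1 := suby 1
  rw [pow_one] at subx1 suby1
  rw [← subx1] at x1
  rw [← subx 3] at x3
  rw [← suby1] at y1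
  rw [← suby 2] at y2
  rw [← suby 3] at y3
  have xs1 := mapCoeff_mul_resolvent hrs τ x (x + y)
  have xs2 := mapCoeff_mul_resolvent hrs τ (x * (x + y)) (x + y)
  have ys1 := mapCoeff_mul_resolvent hrs τ y (x + y)
  have ys2 := mapCoeff_mul_resolvent hrs τ (y * (x + y)) (x + y)
  have yys := mapCoeff_mul_resolvent hrs τ (y ^ 2) (x + y)
  rw [mul_assoc, ← pow_two, hxS] at xs2
  rw [mul_assoc, ← pow_two, hyS] at ys2
  rw [hx0, map_zero] at xs1
  rw [hy0, map_zero] at ys1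
  have hvar : τ (x ^ 2) + τ (y ^ 2) = 1 := by rw [← map_add, hxy]
  have hr2 := hr.coeff_two hx0 hτ
  have hs2 := hs.coeff_two hy0 hτ
  have lin : (∀ n, τ (x * (x + y) ^ n) = τ ((α • (x + y)) * (x + y) ^ n)) ↔
      r = C α * (r + s) := by
    have hsm : (C (α • (x + y)) : A⟦X⟧) = scalarSeries A (C α) * C (x + y) := by
      simp only [scalarSeries, map_C, ← RingHom.map_mul, Algebra.smul_def]
    rw [← mapCoeff_C_mul_resolvent_eq_iff hrs, hsm, mul_assoc, mapCoeff_scalarSeries_mul]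
    rw [← mul_right_inj' (X_ne_zero (R := ℂ)), x1]
    rw [show X * (C α * mapCoeff τ (C (x + y) * resolvent (r + s) (x + y))) = C α * (r + s) by
      linear_combination C α * s1]
  have hsmul : ∀ (c : ℂ) (f : A), mapCoeff τ (C (c • f) * resolvent (r + s) (x + y)) =
      C c * mapCoeff τ (C f * resolvent (r + s) (x + y)) := by
    intro c f
    have hsm : (C (c • f) : A⟦X⟧) = scalarSeries A (C c) * C f := by
      simp only [scalarSeries, map_C, ← RingHom.map_mul, Algebra.smul_def]
    rw [hsm, mul_assoc, mapCoeff_scalarSeries_mul]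
  have hr1 : mapCoeff τ (C 1 * resolvent (r + s) (x + y)) = 1 := by
    rw [map_one, one_mul, hR.2]
  have hK : (C (α * β / (b + 1) ^ 2) : ℂ⟦X⟧) * C ((b + 1) ^ 2) = C α * C β := by
    rw [← map_mul, ← map_mul, div_mul_cancel₀ _ (pow_ne_zero 2 hb)]
  have hK0 : (C (α * β / (b + 1) ^ 2) : ℂ⟦X⟧) ≠ 0 := by
    rw [Ne, map_eq_zero_iff C C_injective]
    exact div_ne_zero (mul_ne_zero hα hβ) (pow_ne_zero 2 hb)
  have hαβ' : (C α : ℂ⟦X⟧) + C β = 1 := by rw [← map_add, hαβ, map_one]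
  have quad (hlin : r = C α * (r + s)) :
      (∀ n, τ (((β • x - α • y) * (x + y) * (β • x - α • y)) * (x + y) ^ n) =
        τ (((α * β / (b + 1) ^ 2) • (b ^ 2 • (x + y) ^ 3 + (2 * b * a) • (x + y) ^ 2 +
          (b + a ^ 2) • (x + y) + a • (1 : A))) * (x + y) ^ n)) ↔
        r + s = X ^ 2 + C a * X * (r + s) + C b * (r + s) ^ 2 := by
    have hlin' : s = C β * (r + s) := by linear_combination -(r + s) * hαβ' - hlin
    -- The linear regression fixes the variances: comparing second coefficients in `r = α (r + s)`
    -- and `s = β (r + s)` gives `α` and `β`.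
    have hρ2 : coeff 2 (r + s) = 1 := by rw [map_add, hr2, hs2, hvar]
    have hvx : τ (x ^ 2) = α := by rw [← hr2, hlin, coeff_C_mul, hρ2, mul_one]
    have hvy : τ (y ^ 2) = β := by rw [← hs2, hlin', coeff_C_mul, hρ2, mul_one]
    rw [← cubic_iff_quadratic hrs hρ2 a b, hz]
    simp only [fun n => trace_cubic_identity htr x y ((x + y) ^ n) α (Commute.self_pow _ n)]
    rw [← mapCoeff_C_mul_resolvent_eq_iff hrs]
    generalize x + y = z at *
    generalize r + s = ρ at *
    simp only [map_add C, map_sub C, add_mul, sub_mul, hsmul, map_add (mapCoeff τ),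
      map_sub (mapCoeff τ), hr1]
    rw [hvx] at x3 xs2
    rw [hvy] at y3 ys2 yys
    rw [hS2, map_one] at s3
    generalize mapCoeff τ (C x * resolvent ρ z) = x1' at *
    generalize mapCoeff τ (C y * resolvent ρ z) = y1' at *
    generalize mapCoeff τ (C (x ^ 3) * resolvent ρ z) = x3' at *
    generalize mapCoeff τ (C (y ^ 3) * resolvent ρ z) = y3' at *
    generalize mapCoeff τ (C (y ^ 2) * resolvent ρ z) = y2' at *
    generalize mapCoeff τ (C z * resolvent ρ z) = s1' at *
    generalize mapCoeff τ (C (z ^ 2) * resolvent ρ z) = s2' at *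
    generalize mapCoeff τ (C (z ^ 3) * resolvent ρ z) = s3' at *
    generalize mapCoeff τ (C (x * z) * resolvent ρ z) = xs1' at *
    generalize mapCoeff τ (C (x * z ^ 2) * resolvent ρ z) = xs2' at *
    generalize mapCoeff τ (C (y * z) * resolvent ρ z) = ys1' at *
    generalize mapCoeff τ (C (y * z ^ 2) * resolvent ρ z) = ys2' at *
    generalize mapCoeff τ (C (y ^ 2 * z) * resolvent ρ z) = yys' at *
    have xs3 : X ^ 3 * xs2' = (1 + ρ) ^ 2 * r - C α * X ^ 2 := by
      linear_combination X ^ 2 * xs2 + X * (1 + ρ) * xs1 + (1 + ρ) ^ 2 * x1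
    have ys3 : X ^ 3 * ys2' = (1 + ρ) ^ 2 * s - C β * X ^ 2 := by
      linear_combination X ^ 2 * ys2 + X * (1 + ρ) * ys1 + (1 + ρ) ^ 2 * y1
    have yys3 : X ^ 3 * yys' = (1 + ρ) * ((1 + s) * s) - C β * X ^ 2 := by
      linear_combination X ^ 2 * yys + (1 + ρ) * y2
    have hβ' : (C β : ℂ⟦X⟧) = 1 - C α := by rw [← hαβ']; ring
    -- Once `r = αρ`, `s = βρ` and `β = 1 - α` are inserted, the terms of degree 2 and 3 in `ρ`
    -- cancel and `αβ(ρ - X²)` remains. The factor `X ^ 3` clears the denominators of the moment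
    -- recursions.
    have lhs : X ^ 3 * (x3' + y3' - C 2 * yys' + ys2' - C (2 * α) * xs2' + C (α ^ 2) * s3') =
        C (α * β / (b + 1) ^ 2) * (C ((b + 1) ^ 2) * (ρ - X ^ 2)) := by
      rw [← mul_assoc (C _), hK]
      simp only [map_mul, map_pow, map_ofNat]
      have : X ^ 3 * (x3' + y3' - 2 * yys' + ys2' - 2 * C α * xs2' + C α ^ 2 * s3') =
          ((1 + r) ^ 2 * r - C α * X ^ 2) + ((1 + s) ^ 2 * s - C β * X ^ 2)
          - 2 * ((1 + ρ) * ((1 + s) * s) - C β * X ^ 2) + ((1 + ρ) ^ 2 * s - C β * X ^ 2)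
          - 2 * C α * ((1 + ρ) ^ 2 * r - C α * X ^ 2)
          + C α ^ 2 * ((1 + ρ) ^ 2 * ρ - 1 * X ^ 2) := by
        rw [← x3, ← y3, ← yys3, ← ys3, ← xs3, ← s3]; ring
      rw [this, hlin', hlin, hβ']
      ring
    have rhs : X ^ 3 * (C (α * β / (b + 1) ^ 2) * (C (b ^ 2) * s3' + C (2 * b * a) * s2' +
        C (b + a ^ 2) * s1' + C a * 1)) = C (α * β / (b + 1) ^ 2) *
        (C b ^ 2 * ((1 + ρ) ^ 2 * ρ - X ^ 2) + 2 * C a * C b * X * ((1 + ρ) * ρ) +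
        (C b + C a ^ 2) * X ^ 2 * ρ + C a * X ^ 3) := by
      simp only [map_mul, map_pow, map_ofNat, map_add]
      linear_combination C (α * β / (b + 1) ^ 2) * (C b ^ 2 * s3 + 2 * C a * C b * X * s2 +
        (C b + C a ^ 2) * X ^ 2 * s1)
    simp only [add_mul] at lhs rhs ⊢
    rw [← mul_right_inj' hK0 (b := C _ * _), ← lhs, ← rhs,
      mul_right_inj' (pow_ne_zero 3 (X_ne_zero (R := ℂ))), map_add C b, add_mul]
  constructor
  · rintro ⟨h1, h2⟩
    obtain ⟨ρ, rfl⟩ : ∃ ρ, r = C α * ρ :=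
      ⟨C α⁻¹ * r, by rw [← mul_assoc, ← map_mul, mul_inv_cancel₀ hα, map_one, one_mul]⟩
    obtain ⟨σ, rfl⟩ : ∃ σ, s = C β * σ :=
      ⟨C β⁻¹ * s, by rw [← mul_assoc, ← map_mul, mul_inv_cancel₀ hβ, map_one, one_mul]⟩
    rw [quadratic_scale_iff hα] at h1
    rw [quadratic_scale_iff hβ] at h2
    -- Both normalized series solve the same quadratic equation, so the two R-transforms are
    -- proportional; this is the linear regression.
    obtain rfl : ρ = σ :=
      eq_of_quadratic (by simpa [hα] using hr.1) (by simpa [hβ] using hs.1) h1 h2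
    have hsum : C α * ρ + C β * ρ = ρ := by rw [← add_mul, hαβ', one_mul]
    rw [hsum] at lin quad
    exact ⟨lin.2 rfl, (quad rfl).2 h1⟩
  · rintro ⟨h1, h2⟩
    have hlin := lin.1 h1
    have hlin' : s = C β * (r + s) := by linear_combination -(r + s) * hαβ' - hlin
    have hq := (quad hlin).1 h2
    generalize r + s = ρ at *
    rw [hlin, hlin', quadratic_scale_iff hα, quadratic_scale_iff hβ]
    exact ⟨hq, hq⟩

end Regression

/-! ### Amplification and the double commutant. -/

section Bicommutant

open scoped lp Pointwise

variable {H : Type*} [NormedAddCommGroup H] [InnerProductSpace ℂ H]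

/-- The diagonal action of an operator on the Hilbert space `ℓ²(ι, H)`. -/
noncomputable def diagonalAction (ι : Type*) (T : H →L[ℂ] H) :
    lp (fun _ : ι => H) 2 →L[ℂ] lp (fun _ : ι => H) 2 :=
  LinearMap.mkContinuous
    { toFun := fun f => ⟨fun i => T (f i), Memℓp.mono' ((lp.memℓp f).const_smul (‖T‖ : ℝ))
        fun i => by simpa [norm_smul] using T.le_opNorm (f i)⟩
      map_add' := fun f g => Subtype.ext (funext fun i => map_add T (f i) (g i))
      map_smul' := fun c f => by ext i; simp }
    ‖T‖ fun f => by
      have : ‖(‖T‖ : ℝ) • f‖ = ‖T‖ * ‖f‖ := by rw [norm_smul, norm_norm]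
      rw [← this]
      refine lp.norm_mono two_ne_zero fun i => ?_
      simpa [norm_smul] using T.le_opNorm (f i)

@[simp]
theorem diagonalAction_apply {ι : Type*} (T : H →L[ℂ] H) (f : lp (fun _ : ι => H) 2) (i : ι) :
    diagonalAction ι T f i = T (f i) := rfl

theorem diagonalAction_mul {ι : Type*} (S T : H →L[ℂ] H) (f : lp (fun _ : ι => H) 2) :
    diagonalAction ι (S * T) f = diagonalAction ι S (diagonalAction ι T f) := by
  ext i; simp

variable [CompleteSpace H]

theorem inner_diagonalAction {ι : Type*} {V : H →L[ℂ] H} (hV : IsSelfAdjoint V)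
    (f g : lp (fun _ : ι => H) 2) :
    inner ℂ f (diagonalAction ι V g) = inner ℂ (diagonalAction ι V f) g := by
  rw [lp.inner_eq_tsum, lp.inner_eq_tsum]
  refine tsum_congr fun i => ?_
  simp only [diagonalAction_apply]
  exact ((ContinuousLinearMap.isSelfAdjoint_iff_isSymmetric.1 hV) (f i) (g i)).symm

/-- The amplified double commutant argument: an element of the double commutant of a self-adjoint
operator `V` is approximated, on any vector of `ℓ²(ι, H)`, by polynomials in `V`. -/
theorem diagonalAction_mem_topologicalClosure {ι : Type*} {V Z : H →L[ℂ] H}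
    (hV : IsSelfAdjoint V)
    (hZ : Z ∈ Set.centralizer (Set.centralizer {V})) (η : lp (fun _ : ι => H) 2) :
    diagonalAction ι Z η ∈
      (Submodule.span ℂ (Set.range fun n : ℕ => diagonalAction ι (V ^ n) η)).topologicalClosure := by
  classical
  set D := (Submodule.span ℂ
    (Set.range fun n : ℕ => diagonalAction ι (V ^ n) η)).topologicalClosure with hD
  have hDc : IsClosed (D : Set (lp (fun _ : ι => H) 2)) := Submodule.isClosed_topologicalClosure _
  have : CompleteSpace D := hDc.completeSpace_coe
  have hη : η ∈ D := Submodule.le_topologicalClosure _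
    (Submodule.subset_span ⟨0, by ext i; simp⟩)
  have hinv : ∀ f ∈ D, diagonalAction ι V f ∈ D := by
    have : D ≤ D.comap (diagonalAction ι V).toLinearMap := by
      refine Submodule.topologicalClosure_minimal _ (Submodule.span_le.2 ?_)
        (hDc.preimage (diagonalAction ι V).continuous)
      rintro _ ⟨n, rfl⟩
      refine Submodule.le_topologicalClosure _ (Submodule.subset_span ⟨n + 1, ?_⟩)
      change diagonalAction ι (V ^ (n + 1)) η = diagonalAction ι V (diagonalAction ι (V ^ n) η)
      rw [pow_succ', diagonalAction_mul]
    exact this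
  -- As `V` is self-adjoint, invariance of `D` passes to its orthogonal complement, so the
  -- projection onto `D` commutes with the amplified `V`.
  have horth : ∀ f ∈ Dᗮ, diagonalAction ι V f ∈ Dᗮ := by
    intro f hf
    rw [Submodule.mem_orthogonal] at hf ⊢
    intro g hg
    rw [inner_diagonalAction hV]
    exact hf _ (hinv g hg)
  have hcomm : ∀ f, D.starProjection (diagonalAction ι V f) =
      diagonalAction ι V (D.starProjection f) := by
    intro f
    refine Submodule.eq_starProjection_of_mem_orthogonal
      (hinv _ (Submodule.starProjection_apply_mem _ _)) ?_
    rw [← map_sub]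
    exact horth _ (Submodule.sub_starProjection_mem_orthogonal _)
  -- These are the matrix entries of the projection. Each commutes with `V`, hence with `Z`;
  -- therefore the projection commutes with the amplified `Z` and fixes `Z η`, as it fixes `η`.
  let P : ι → ι → H →L[ℂ] H := fun i j =>
    (lp.evalCLM ℂ (fun _ : ι => H) 2 i) ∘L D.starProjection ∘L
      (lp.singleContinuousLinearMap ℂ (fun _ : ι => H) 2 j)
  have hdiag : ∀ (T : H →L[ℂ] H) (j : ι) (v : H),
      diagonalAction ι T (lp.single 2 j v) = lp.single 2 j (T v) := by
    intro T j v
    ext i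
    rw [diagonalAction_apply]
    rcases eq_or_ne i j with rfl | h
    · simp
    · simp [lp.single_apply, h]
  have hPV : ∀ i j, P i j ∈ Set.centralizer {V} := by
    intro i j
    rw [Set.mem_centralizer_iff]
    intro S hS
    rw [Set.mem_singleton_iff.1 hS]
    ext v
    change V ((D.starProjection (lp.single 2 j v)) i) = (D.starProjection (lp.single 2 j (V v))) i
    rw [← hdiag, hcomm, diagonalAction_apply]
  have hPZ : ∀ i j v, P i j (Z v) = Z (P i j v) := fun i j v =>
    congrArg (fun T : H →L[ℂ] H => T v) (Set.mem_centralizer_iff.1 hZ _ (hPV i j))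
  have hsum : ∀ (f : lp (fun _ : ι => H) 2) i,
      HasSum (fun j => P i j (f j)) ((D.starProjection f) i) := fun f i =>
    ((lp.hasSum_single (by simp) f).mapL D.starProjection).mapL
      (lp.evalCLM ℂ (fun _ : ι => H) 2 i)
  have hfix : D.starProjection (diagonalAction ι Z η) = diagonalAction ι Z η := by
    ext i
    have h1 := hsum (diagonalAction ι Z η) i
    have h2 := (hsum η i).mapL Z
    simp only [diagonalAction_apply, hPZ] at h1
    rw [h1.unique h2, diagonalAction_apply, Submodule.starProjection_eq_self_iff.2 hη]
  rw [← hfix]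
  exact Submodule.starProjection_apply_mem _ _

/-- The von Neumann algebra generated by a self-adjoint operator is contained in its double
commutant. -/
theorem generatedBy_subset_bicommutant {V Z : H →L[ℂ] H} (hV : IsSelfAdjoint V)
    (hZ : Z ∈ generatedBy {V}) : Z ∈ Set.centralizer (Set.centralizer {V}) := by
  -- The star-algebra centralizer also requires commutation with adjoints; for self-adjoint `V` it
  -- is the ordinary centralizer.
  have hV' : ({V} : Set (H →L[ℂ] H)) ∪ star {V} = {V} := by
    rw [Set.star_singleton, hV.star_eq, Set.union_self]
  let S : StarSubalgebra ℂ (H →L[ℂ] H) :=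
    StarSubalgebra.centralizer ℂ (StarSubalgebra.centralizer ℂ {V} : Set (H →L[ℂ] H))
  have hS : (S : Set (H →L[ℂ] H)) = Set.centralizer (Set.centralizer {V}) := by
    have : star (Set.centralizer ({V} : Set (H →L[ℂ] H))) = Set.centralizer {V} := by
      rw [← hV', ← StarSubalgebra.coe_centralizer ℂ]
      exact StarMemClass.star_coe_eq _
    simp [S, hV', this]
  let M : VonNeumannAlgebra H :=
    ⟨S, by
      change Set.centralizer (Set.centralizer (S : Set (H →L[ℂ] H))) = S
      rw [hS, Set.centralizer_centralizer_centralizer]⟩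
  have hM : (M : Set (H →L[ℂ] H)) = Set.centralizer (Set.centralizer {V}) := hS
  rw [← hM]
  refine mem_generatedBy.1 hZ M ?_
  rw [hM]
  exact Set.subset_centralizer_centralizer

end Bicommutant

/-! ### Normal functionals and conditional expectations tested on powers. -/

section Normal

universe u

variable {H : Type u} [NormedAddCommGroup H] [InnerProductSpace ℂ H] [CompleteSpace H]
  {𝒜 : VonNeumannAlgebra H}

theorem memℓp_two_of_summable {ι E : Type*} [NormedAddCommGroup E] {f : ι → E}
    (hf : Summable fun i => ‖f i‖ ^ 2) : Memℓp f 2 :=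
  memℓp_gen (by simpa using hf)

/-- A functional that is continuous for the ultraweak topology is a vector functional in an
amplification. -/
theorem exists_eq_inner_diagonalAction (τ : 𝒜.toStarSubalgebra →ₗ[ℂ] ℂ)
    (hτ : @Continuous _ _ (TopologicalSpace.induced
      (Subtype.val : 𝒜.toStarSubalgebra → (H →L[ℂ] H)) (ultraweakTopology H)) _ τ) :
    ∃ (ι : Type u) (ξ η : lp (fun _ : ι => H) 2),
      ∀ T : 𝒜.toStarSubalgebra, τ T = inner ℂ ξ (diagonalAction ι (T : H →L[ℂ] H) η) := by
  let I := {p : (ℕ → H) × (ℕ → H) //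
      Summable (fun n => ‖p.1 n‖ ^ 2) ∧ Summable (fun n => ‖p.2 n‖ ^ 2)}
  let left : I → lp (fun _ : ℕ => H) 2 := fun p => ⟨p.1.1, memℓp_two_of_summable p.2.1⟩
  let right : I → lp (fun _ : ℕ => H) 2 := fun p => ⟨p.1.2, memℓp_two_of_summable p.2.2⟩
  let F : I → 𝒜.toStarSubalgebra →ₗ[ℂ] ℂ := fun p =>
    { toFun := fun T => inner ℂ (left p) (diagonalAction ℕ (T : H →L[ℂ] H) (right p))
      map_add' := fun S T => by
        rw [← inner_add_right]; congr 1
      map_smul' := fun c T => by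
        rw [RingHom.id_apply, smul_eq_mul, ← inner_smul_right]; congr 1 }
  have hF : ∀ p T, F p T = ∑' n, inner ℂ (p.1.1 n) ((T : H →L[ℂ] H) (p.1.2 n)) := fun p T =>
    lp.inner_eq_tsum _ _
  -- A linear functional continuous for the topology induced by a family of functionals is a finite
  -- linear combination of them.
  have hspan : τ ∈ Submodule.span ℂ (Set.range F) := by
    rw [LinearMap.mem_span_iff_continuous]
    convert hτ using 1
    rw [ultraweakTopology, induced_iInf]
    refine iInf_congr fun p => ?_
    rw [induced_compose]
    congr 1
  obtain ⟨c, hc⟩ := (Finsupp.mem_span_range_iff_exists_finsupp).1 hspan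
  have hprod : ∀ (f : c.support × ℕ → H), (∀ p, Summable fun n => ‖f (p, n)‖ ^ 2) →
      Summable fun q => ‖f q‖ ^ 2 := by
    intro f hf
    rw [summable_prod_of_nonneg (fun q => by positivity)]
    exact ⟨hf, Summable.of_finite⟩
  -- The finitely many sequences are stacked into one vector. The coefficients are conjugated
  -- because the inner product is conjugate-linear in its first argument.
  let ξ : lp (fun _ : c.support × ℕ => H) 2 :=
    ⟨fun q => (starRingEnd ℂ) (c q.1) • q.1.1.1.1 q.2, memℓp_two_of_summable (hprod _ fun p => by
      simp only [norm_smul, mul_pow]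
      exact p.1.2.1.mul_left _)⟩
  let η : lp (fun _ : c.support × ℕ => H) 2 :=
    ⟨fun q => q.1.1.1.2 q.2, memℓp_two_of_summable (hprod _ fun p => p.1.2.2)⟩
  refine ⟨c.support × ℕ, ξ, η, fun T => ?_⟩
  have hs : Summable fun q => inner ℂ (ξ q) ((T : H →L[ℂ] H) (η q)) :=
    lp.summable_inner ξ (diagonalAction _ (T : H →L[ℂ] H) η)
  have h1 : inner ℂ ξ (diagonalAction _ (T : H →L[ℂ] H) η) =
      ∑' q, inner ℂ (ξ q) ((T : H →L[ℂ] H) (η q)) := lp.inner_eq_tsum _ _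
  have h2 : τ T = ∑ p : c.support, c p * F p T := by
    rw [← hc, Finsupp.sum, LinearMap.sum_apply]
    exact (Finset.sum_coe_sort c.support fun p => c p * F p T).symm
  rw [h1, Summable.tsum_prod hs, tsum_fintype, h2]
  refine Finset.sum_congr rfl fun p _ => ?_
  rw [hF, ← tsum_mul_left]
  refine tsum_congr fun n => ?_
  have h3 : ξ (p, n) = (starRingEnd ℂ) (c p) • p.1.1.1 n := rfl
  rw [h3, inner_smul_left, Complex.conj_conj]

/-- Conditional expectations onto the von Neumann algebra generated by `V` may be tested on powers
of `V`. -/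
theorem isCondExp_iff_pow {τ : 𝒜.toStarSubalgebra →ₗ[ℂ] ℂ}
    (hτ : IsNormalFaithfulTracialState 𝒜 τ) {U V W : 𝒜.toStarSubalgebra} (hV : IsSelfAdjoint V)
    (hW : W ∈ (Polynomial.aeval (R := ℂ) V).range) :
    IsCondExp τ U V W ↔ ∀ n : ℕ, τ (U * V ^ n) = τ (W * V ^ n) := by
  have hVgen : (V : H →L[ℂ] H) ∈ generatedBy {(V : H →L[ℂ] H)} :=
    mem_generatedBy.2 fun M hM => hM rfl
  have hpoly : ∀ p : Polynomial ℂ,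
      ((Polynomial.aeval V p : 𝒜.toStarSubalgebra) : H →L[ℂ] H) ∈
        generatedBy {(V : H →L[ℂ] H)} := by
    intro p
    have h1 : ((Polynomial.aeval V p : 𝒜.toStarSubalgebra) : H →L[ℂ] H) =
        Polynomial.aeval (V : H →L[ℂ] H) p :=
      Polynomial.aeval_subalgebra_coe p 𝒜.toStarSubalgebra.toSubalgebra V
    have h2 := Polynomial.aeval_subalgebra_coe p
      (generatedBy {(V : H →L[ℂ] H)}).toStarSubalgebra.toSubalgebra ⟨V, hVgen⟩
    rw [h1, ← h2]
    exact Subtype.prop _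
  constructor
  · rintro ⟨-, h⟩ n
    exact h _ (by simpa using hpoly (Polynomial.X ^ n))
  · intro h
    refine ⟨by obtain ⟨p, rfl⟩ := hW; exact hpoly p, fun Z hZ => ?_⟩
    obtain ⟨ι, ξ, η, hξη⟩ := exists_eq_inner_diagonalAction τ hτ.normal
    have hVs : IsSelfAdjoint (V : H →L[ℂ] H) := congrArg Subtype.val hV
    have hmem := diagonalAction_mem_topologicalClosure hVs
      (generatedBy_subset_bicommutant hVs hZ) η
    have key : ∀ T : 𝒜.toStarSubalgebra, τ (U * T) - τ (W * T) =
        inner ℂ (ContinuousLinearMap.adjoint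
          (diagonalAction ι ((U - W : 𝒜.toStarSubalgebra) : H →L[ℂ] H)) ξ)
          (diagonalAction ι (T : H →L[ℂ] H) η) := by
      intro T
      rw [ContinuousLinearMap.adjoint_inner_left, ← diagonalAction_mul, ← map_sub, ← sub_mul]
      exact hξη _
    set χ := ContinuousLinearMap.adjoint
      (diagonalAction ι ((U - W : 𝒜.toStarSubalgebra) : H →L[ℂ] H)) ξ
    -- Orthogonality of `χ` to all `V ^ n η` extends to their closed span, which contains `Z η`.
    have hle : (Submodule.span ℂ
        (Set.range fun n : ℕ => diagonalAction ι ((V : H →L[ℂ] H) ^ n) η)).topologicalClosure ≤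
        (innerSL ℂ χ).ker := by
      refine Submodule.topologicalClosure_minimal _ (Submodule.span_le.2 ?_)
        (ContinuousLinearMap.isClosed_ker _)
      rintro _ ⟨n, rfl⟩
      have := key (V ^ n)
      rw [h n, sub_self] at this
      exact this.symm
    rw [← sub_eq_zero, key]
    exact hle hmem

end Normal

/-! ### Evaluation of convergent power series. -/

section Evaluation

open PowerSeries Filter Topology

/-- The power series `F` converges at `w`, with sum `v`. -/
def EvaluatesTo (w : ℂ) (F : ℂ⟦X⟧) (v : ℂ) : Prop := HasSum (fun n => coeff n F * w ^ n) v

namespace EvaluatesTo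

variable {w u v : ℂ} {F G : ℂ⟦X⟧}

theorem add (hF : EvaluatesTo w F u) (hG : EvaluatesTo w G v) : EvaluatesTo w (F + G) (u + v) := by
  simpa [EvaluatesTo, add_mul] using HasSum.add hF hG

theorem sub (hF : EvaluatesTo w F u) (hG : EvaluatesTo w G v) : EvaluatesTo w (F - G) (u - v) := by
  simpa [EvaluatesTo, sub_mul] using HasSum.sub hF hG

theorem const (w c : ℂ) : EvaluatesTo w (C c) c := by
  have := hasSum_single (f := fun n => coeff n (C c) * w ^ n) 0 fun n hn => by simp [coeff_C, hn]
  simpa [EvaluatesTo] using this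

theorem var (w : ℂ) : EvaluatesTo w X w := by
  have := hasSum_single (f := fun n => coeff n (X : ℂ⟦X⟧) * w ^ n) 1
    fun n hn => by simp [coeff_X, hn]
  simpa [EvaluatesTo] using this

theorem mul (hF : EvaluatesTo w F u) (hG : EvaluatesTo w G v) : EvaluatesTo w (F * G) (u * v) := by
  have hF' := hF.summable.norm
  have hG' := hG.summable.norm
  have e : (fun n => coeff n (F * G) * w ^ n) = fun n => ∑ kl ∈ Finset.HasAntidiagonal.antidiagonal n,
      (coeff kl.1 F * w ^ kl.1) * (coeff kl.2 G * w ^ kl.2) := by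
    ext n
    rw [coeff_mul, Finset.sum_mul]
    refine Finset.sum_congr rfl fun p hp => ?_
    rw [← Finset.HasAntidiagonal.mem_antidiagonal.1 hp, pow_add]
    ring
  have h1 := (summable_norm_sum_mul_antidiagonal_of_summable_norm hF' hG').of_norm.hasSum
  rw [← tsum_mul_tsum_eq_tsum_sum_antidiagonal_of_summable_norm hF' hG', hF.tsum_eq,
    hG.tsum_eq] at h1
  rw [EvaluatesTo, e]
  exact h1

theorem unique (h : EvaluatesTo w F u) (h' : EvaluatesTo w F v) : u = v := HasSum.unique h h'

end EvaluatesTo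

/-- A power series that converges near `0` and vanishes at points accumulating at `0` is zero. -/
theorem eq_zero_of_frequently_evaluatesTo_zero {F : ℂ⟦X⟧} {f : ℂ → ℂ}
    (hf : ∀ᶠ w in 𝓝 0, EvaluatesTo w F (f w)) (h0 : ∃ᶠ w in 𝓝[≠] (0 : ℂ), f w = 0) : F = 0 := by
  have hp : HasFPowerSeriesAt f (FormalMultilinearSeries.ofScalars ℂ fun n => coeff n F) 0 := by
    rw [hasFPowerSeriesAt_iff]
    filter_upwards [hf] with w hw
    simpa [EvaluatesTo, FormalMultilinearSeries.coeff_ofScalars, mul_comm] using hw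
  have hz := hp.analyticAt.frequently_zero_iff_eventually_zero.1 h0
  have := hp.eq_zero_of_eventually hz
  rw [FormalMultilinearSeries.ofScalars_series_eq_zero] at this
  ext n
  simpa using congrFun this n

end Evaluation

/-! ### The Cauchy transform and the Meixner equation for the moments. -/

section Cauchy

open MeasureTheory PowerSeries Filter Topology

variable {μ : Measure ℝ}

theorem IsCompactlySupportedProbability.exists_bound (h : IsCompactlySupportedProbability μ) :
    ∃ R : ℝ, 0 < R ∧ ∀ᵐ t ∂μ, |t| ≤ R := by
  obtain ⟨-, K, hK, hμ⟩ := h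
  obtain ⟨R, hR⟩ := hK.isBounded.exists_norm_le
  refine ⟨max R 1, by positivity, ?_⟩
  have : ∀ᵐ t ∂μ, t ∈ K := hμ
  filter_upwards [this] with t ht
  exact (hR t ht).trans (le_max_left _ _)

/-- The generating function of the moments of a measure. -/
noncomputable def measureMomentSeries (μ : Measure ℝ) : ℂ⟦X⟧ :=
  PowerSeries.mk fun n => ((∫ t : ℝ, t ^ n ∂μ : ℝ) : ℂ)

/-- Near infinity, the Cauchy transform is given by the moments. -/
theorem evaluatesTo_measureMomentSeries [IsProbabilityMeasure μ] {R : ℝ} (hR : 0 < R)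
    (hμ : ∀ᵐ t ∂μ, |t| ≤ R) {z : ℂ} (hz : R < ‖z‖) :
    EvaluatesTo z⁻¹ (measureMomentSeries μ) (z * cauchyTransform μ z) := by
  have hz0 : z ≠ 0 := by
    rintro rfl
    simp at hz
    linarith
  have hzpos : 0 < ‖z‖ := hR.trans hz
  set q := R / ‖z‖ with hq
  have hq0 : 0 ≤ q := by positivity
  have hq1 : q < 1 := (div_lt_one hzpos).2 hz
  have hbound : ∀ n, ∀ᵐ t : ℝ ∂μ, ‖((t : ℂ) * z⁻¹) ^ n‖ ≤ q ^ n := by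
    intro n
    filter_upwards [hμ] with t ht
    rw [norm_pow, norm_mul, norm_inv, Complex.norm_real, Real.norm_eq_abs, ← div_eq_mul_inv]
    exact pow_le_pow_left₀ (by positivity) (div_le_div_of_nonneg_right ht hzpos.le) n
  have hmeas : ∀ n, AEStronglyMeasurable (fun t : ℝ => ((t : ℂ) * z⁻¹) ^ n) μ := fun n =>
    (by fun_prop : Continuous fun t : ℝ => ((t : ℂ) * z⁻¹) ^ n).aestronglyMeasurable
  have hint : ∀ n, Integrable (fun t : ℝ => ((t : ℂ) * z⁻¹) ^ n) μ := fun n =>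
    Integrable.of_bound (hmeas n) _ (hbound n)
  have hsum := hasSum_integral_of_summable_integral_norm hint (by
    refine Summable.of_nonneg_of_le (fun n => integral_nonneg fun t => norm_nonneg _) (fun n => ?_)
      (summable_geometric_of_lt_one hq0 hq1)
    calc ∫ t, ‖((t : ℂ) * z⁻¹) ^ n‖ ∂μ ≤ ∫ _, q ^ n ∂μ :=
          integral_mono_ae (hint n).norm (integrable_const _) (hbound n)
      _ = q ^ n := by simp)
  have e1 : (fun n => coeff n (measureMomentSeries μ) * z⁻¹ ^ n) =
      fun n => ∫ t : ℝ, ((t : ℂ) * z⁻¹) ^ n ∂μ := by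
    ext n
    simp only [measureMomentSeries, coeff_mk, mul_pow]
    rw [integral_mul_const, ← integral_complex_ofReal]
    simp
  have e2 : z * cauchyTransform μ z = ∫ t : ℝ, ∑' n : ℕ, ((t : ℂ) * z⁻¹) ^ n ∂μ := by
    unfold cauchyTransform
    rw [← integral_const_mul]
    refine integral_congr_ae ?_
    filter_upwards [hμ] with t ht
    have h1 : ‖(t : ℂ) * z⁻¹‖ < 1 := by
      rw [norm_mul, norm_inv, Complex.norm_real, Real.norm_eq_abs, ← div_eq_mul_inv]
      exact (div_lt_one hzpos).2 (ht.trans_lt hz)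
    rw [tsum_geometric_of_norm_lt_one h1]
    have h2 : z - t ≠ 0 := by
      intro h
      rw [sub_eq_zero.1 h, Complex.norm_real, Real.norm_eq_abs] at hz
      linarith
    have h3 : 1 - (t : ℂ) * z⁻¹ ≠ 0 := by
      intro h
      apply h2
      have : (1 - (t : ℂ) * z⁻¹) * z = z - t := by field_simp
      rw [← this, h, zero_mul]
    field_simp
  rw [EvaluatesTo, e1, e2]
  exact hsum

/-- Differentiation under the integral: on the ball of radius `Im z / 2` about `z`, the distance to
the real line is at least that radius, which bounds the derivative of the kernel uniformly. -/
theorem differentiableOn_cauchyTransform [IsProbabilityMeasure μ] :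
    DifferentiableOn ℂ (cauchyTransform μ) {z : ℂ | 0 < z.im} := by
  intro z hz
  have hz' : 0 < z.im := hz
  set δ := z.im / 2 with hδ
  have hδ0 : 0 < δ := by positivity
  have hlow : ∀ x ∈ Metric.ball z δ, ∀ t : ℝ, δ ≤ ‖x - t‖ := by
    intro x hx t
    have h1 : |(x - z).im| ≤ ‖x - z‖ := Complex.abs_im_le_norm _
    have h2 : |(x - t).im| ≤ ‖x - t‖ := Complex.abs_im_le_norm _
    rw [Metric.mem_ball, dist_eq_norm] at hx
    simp only [Complex.sub_im, Complex.ofReal_im, sub_zero] at h1 h2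
    have := abs_le.1 (h1.trans hx.le)
    have := (abs_le.1 h2).2
    linarith [le_abs_self x.im]
  have hne : ∀ x ∈ Metric.ball z δ, ∀ t : ℝ, x - t ≠ 0 := fun x hx t h => by
    have := hlow x hx t
    rw [h, norm_zero] at this
    linarith
  have hcont : ∀ x ∈ Metric.ball z δ, Continuous fun t : ℝ => 1 / (x - (t : ℂ)) := fun x hx =>
    continuous_const.div (by fun_prop) (hne x hx)
  have hzb : z ∈ Metric.ball z δ := Metric.mem_ball_self hδ0
  have := hasDerivAt_integral_of_dominated_loc_of_deriv_le (μ := μ) (𝕜 := ℂ)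
    (F := fun x (t : ℝ) => 1 / (x - (t : ℂ))) (F' := fun x (t : ℝ) => -1 / (x - (t : ℂ)) ^ 2)
    (x₀ := z) (s := Metric.ball z δ) (bound := fun _ => (δ ^ 2)⁻¹) (Metric.ball_mem_nhds z hδ0)
    (by filter_upwards [Metric.ball_mem_nhds z hδ0] with x hx
        exact (hcont x hx).aestronglyMeasurable)
    (Integrable.of_bound (hcont z hzb).aestronglyMeasurable δ⁻¹ (by
      filter_upwards with t
      rw [norm_div, norm_one, one_div]
      exact inv_anti₀ hδ0 (hlow z hzb t)))
    (continuous_const.div (by fun_prop)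
      fun t => pow_ne_zero 2 (hne z hzb t)).aestronglyMeasurable
    (by
      filter_upwards with t x hx
      rw [norm_div, norm_neg, norm_one, one_div, norm_pow]
      have := hlow x hx t
      exact inv_anti₀ (by positivity) (by gcongr))
    (integrable_const _)
    (by
      filter_upwards with t x hx
      have h1 : HasDerivAt (fun y : ℂ => y - (t : ℂ)) 1 x := (hasDerivAt_id x).sub_const _
      have h2 := h1.inv (hne x hx t)
      simpa only [one_div] using! h2)
  exact this.2.differentiableAt.differentiableWithinAt

/-- The quadratic equation for the moment generating function of a free Meixner law. -/
def MeixnerEquation (a b c : ℂ) (M : ℂ⟦X⟧) : Prop :=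
  M ^ 2 * (C c * X ^ 2 + C a * X + C b) - M * (C a * X + 1 + 2 * C b) + (1 + C b) = 0

theorem EvaluatesTo.meixner {w v : ℂ} {M : ℂ⟦X⟧} (h : EvaluatesTo w M v) (a b c : ℂ) :
    EvaluatesTo w
      (M ^ 2 * (C c * X ^ 2 + C a * X + C b) - M * (C a * X + 1 + 2 * C b) + (1 + C b))
      (v ^ 2 * (c * w ^ 2 + a * w + b) - v * (a * w + 1 + 2 * b) + (1 + b)) := by
  have h1 : EvaluatesTo w 1 1 := by simpa using EvaluatesTo.const w 1
  have h2 : EvaluatesTo w 2 2 := by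
    rw [← map_ofNat C]
    exact EvaluatesTo.const w 2
  have hX := EvaluatesTo.var w
  have hc := EvaluatesTo.const w
  simp only [pow_two]
  exact (((h.mul h).mul ((((hc c).mul (hX.mul hX)).add ((hc a).mul hX)).add (hc b))).sub
    (h.mul ((((hc a).mul hX).add h1).add (h2.mul (hc b))))).add (h1.add (hc b))

/-- Solving for the root and squaring makes the choice of branch irrelevant. The quadratic equation
so obtained holds at `z = i y` for large `y`, and the points `1 / z` accumulate at 0, which is
enough for an identity of power series. -/
theorem IsFreeMeixnerLaw.meixnerEquation {a b : ℝ} (h : IsFreeMeixnerLaw a b μ) :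
    MeixnerEquation a b 1 (measureMomentSeries μ) := by
  obtain ⟨hμ, s, -, hs, hG⟩ := h
  have := hμ.1
  obtain ⟨R, hR, hbd⟩ := hμ.exists_bound
  let g : ℂ → ℂ := fun w => if w = 0 then 1 else w⁻¹ * cauchyTransform μ w⁻¹
  have hg : ∀ᶠ w in 𝓝 (0 : ℂ), EvaluatesTo w (measureMomentSeries μ) (g w) := by
    filter_upwards [Metric.ball_mem_nhds (0 : ℂ) (inv_pos.2 hR)] with w hw
    rw [mem_ball_zero_iff] at hw
    by_cases h0 : w = 0
    · subst h0
      have := hasSum_single (f := fun n => coeff n (measureMomentSeries μ) * (0 : ℂ) ^ n) 0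
        fun n hn => by simp [hn]
      simpa [EvaluatesTo, g, measureMomentSeries] using this
    · have h1 : R < ‖w⁻¹‖ := by
        rw [norm_inv]
        exact (lt_inv_comm₀ (norm_pos_iff.2 h0) hR).1 hw
      simpa [g, h0] using evaluatesTo_measureMomentSeries hR hbd h1
  refine eq_zero_of_frequently_evaluatesTo_zero (hg.mono fun w hw => hw.meixner a b 1) ?_
  have htend : Tendsto (fun y : ℝ => ((y : ℂ) * Complex.I)⁻¹) atTop (𝓝[≠] 0) := by
    refine tendsto_nhdsWithin_iff.2 ⟨?_, ?_⟩
    · refine tendsto_inv₀_cobounded.comp ?_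
      rw [← tendsto_norm_atTop_iff_cobounded]
      simpa using tendsto_abs_atTop_atTop
    · filter_upwards [eventually_gt_atTop 0] with y hy
      simp [hy.ne']
  refine htend.frequently (Eventually.frequently ?_)
  -- At `z = i y` the denominator has real part `1 - b y²`. A zero would force `b > 0`, and then `y
  -- > 1` and `b y > 1` contradict it.
  filter_upwards [eventually_gt_atTop 1, eventually_gt_atTop b⁻¹] with y hy1 hyb
  obtain ⟨z, hz⟩ : ∃ z : ℂ, z = (y : ℂ) * Complex.I := ⟨_, rfl⟩
  rw [← hz]
  have hzim : 0 < z.im := by simp [hz]; linarith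
  have hz0 : z ≠ 0 := by rintro h; rw [h] at hzim; simp at hzim
  have hP : (b : ℂ) * z ^ 2 + (a : ℂ) * z + 1 ≠ 0 := by
    intro h
    have h1 := congrArg Complex.re h
    have h2 : z ^ 2 = ((-(y ^ 2) : ℝ) : ℂ) := by
      rw [hz, mul_pow, Complex.I_sq]; push_cast; ring
    have h3 : z.re = 0 := by simp [hz]
    simp only [h2, Complex.add_re, Complex.re_ofReal_mul, Complex.ofReal_re, h3, Complex.one_re,
      Complex.zero_re] at h1
    have hb0 : 0 < b := by nlinarith
    have hby : 1 < b * y := by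
      have := mul_lt_mul_of_pos_left hyb hb0
      rwa [mul_inv_cancel₀ hb0.ne'] at this
    nlinarith
  have hGz := hG z hzim hP
  rw [eq_div_iff (mul_ne_zero two_ne_zero hP)] at hGz
  have hsz : s z = (1 + 2 * (b : ℂ)) * z + a -
      2 * ((b : ℂ) * z ^ 2 + a * z + 1) * cauchyTransform μ z := by
    linear_combination hGz
  have hsq := hs z hzim
  rw [hsz] at hsq
  have key : ((b : ℂ) * z ^ 2 + a * z + 1) * (((b : ℂ) * z ^ 2 + a * z + 1) *
      cauchyTransform μ z ^ 2 - ((1 + 2 * b) * z + a) * cauchyTransform μ z + (1 + b)) = 0 := by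
    linear_combination hsq / 4
  have key2 := (mul_eq_zero.1 key).resolve_left hP
  have hgz : g z⁻¹ = z * cauchyTransform μ z := by simp [g, hz0]
  rw [hgz]
  field_simp
  linear_combination key2

/-- The equation for the Cauchy transform holds outside a disc by the moment expansion, and on the
whole upper half plane by the identity theorem. The branch of the root is then read off from the
formula for the transform; its square is the discriminant of the quadratic. -/
theorem isFreeMeixnerLaw_of_meixnerEquation {a b : ℝ} (hμ : IsCompactlySupportedProbability μ)
    (h : MeixnerEquation a b 1 (measureMomentSeries μ)) : IsFreeMeixnerLaw a b μ := by
  have := hμ.1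
  obtain ⟨R, hR, hbd⟩ := hμ.exists_bound
  have hopen : IsOpen {z : ℂ | 0 < z.im} := isOpen_lt continuous_const Complex.continuous_im
  have hdiff := differentiableOn_cauchyTransform (μ := μ)
  let K : ℂ → ℂ := fun z => ((b : ℂ) * z ^ 2 + a * z + 1) * cauchyTransform μ z ^ 2 -
    ((1 + 2 * b) * z + a) * cauchyTransform μ z + (1 + b)
  have hK : DifferentiableOn ℂ K {z : ℂ | 0 < z.im} := by
    have h1 : DifferentiableOn ℂ (fun z : ℂ => (b : ℂ) * z ^ 2 + a * z + 1) {z : ℂ | 0 < z.im} := by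
      fun_prop
    have h2 : DifferentiableOn ℂ (fun z : ℂ => (1 + 2 * (b : ℂ)) * z + a) {z : ℂ | 0 < z.im} := by
      fun_prop
    exact ((h1.mul (hdiff.pow 2)).sub (h2.mul hdiff)).add_const _
  have hfar : ∀ z : ℂ, R < ‖z‖ → K z = 0 := by
    intro z hz
    have hz0 : z ≠ 0 := norm_pos_iff.1 (hR.trans hz)
    have h1 := (evaluatesTo_measureMomentSeries hR hbd hz).meixner a b 1
    rw [MeixnerEquation] at h
    rw [h] at h1
    have h2 := h1.unique (by simpa using EvaluatesTo.const z⁻¹ 0)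
    field_simp at h2
    simp only [K]
    linear_combination h2
  have hzero : ∀ z : ℂ, 0 < z.im → K z = 0 := by
    have hz0 : (((R + 1 : ℝ) : ℂ) * Complex.I) ∈ {z : ℂ | 0 < z.im} := by
      simp; linarith
    have hev : K =ᶠ[𝓝 (((R + 1 : ℝ) : ℂ) * Complex.I)] 0 := by
      have : {z : ℂ | R < ‖z‖} ∈ 𝓝 (((R + 1 : ℝ) : ℂ) * Complex.I) := by
        refine (isOpen_lt continuous_const continuous_norm).mem_nhds ?_
        simp only [Set.mem_ofPred_eq, norm_mul, Complex.norm_real, Complex.norm_I, mul_one,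
          Real.norm_eq_abs]
        exact (lt_add_one R).trans_le (le_abs_self _)
      filter_upwards [this] with z hz
      exact hfar z hz
    have hconn : IsPreconnected {z : ℂ | 0 < z.im} := (convex_halfSpace_im_gt 0).isPreconnected
    intro z hz
    exact (hK.analyticOnNhd hopen).eqOn_zero_of_preconnected_of_eventuallyEq_zero hconn hz0 hev hz
  refine ⟨hμ, fun z => ((1 + 2 * b) * z + a) - 2 * ((b : ℂ) * z ^ 2 + a * z + 1) *
    cauchyTransform μ z, ?_, fun z hz => ?_, fun z hz hP => ?_⟩
  · have h1 : DifferentiableOn ℂ (fun z : ℂ => 2 * ((b : ℂ) * z ^ 2 + a * z + 1))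
        {z : ℂ | 0 < z.im} := by fun_prop
    have h2 : DifferentiableOn ℂ (fun z : ℂ => (1 + 2 * (b : ℂ)) * z + a) {z : ℂ | 0 < z.im} := by
      fun_prop
    exact h2.sub (h1.mul hdiff)
  · have := hzero z hz
    simp only [K] at this
    linear_combination 4 * ((b : ℂ) * z ^ 2 + a * z + 1) * this
  · rw [eq_div_iff (mul_ne_zero two_ne_zero hP)]
    ring

end Cauchy

/-! ### Laws of self-adjoint elements and rescaling. -/

section Law

open MeasureTheory CompactlySupported

variable {H : Type*} [NormedAddCommGroup H] [InnerProductSpace ℂ H] [CompleteSpace H]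
  {𝒜 : VonNeumannAlgebra H} {τ : 𝒜.toStarSubalgebra →ₗ[ℂ] ℂ}

theorem isClosed_vonNeumannAlgebra (𝒜 : VonNeumannAlgebra H) :
    IsClosed (𝒜.toStarSubalgebra : Set (H →L[ℂ] H)) := by
  rw [VonNeumannAlgebra.coe_toStarSubalgebra, ← VonNeumannAlgebra.centralizer_centralizer]
  exact Set.isClosed_centralizer _

open scoped ComplexOrder in
theorem IsNormalFaithfulTracialState.im_eq_zero (hτ : IsNormalFaithfulTracialState 𝒜 τ)
    {x : 𝒜.toStarSubalgebra} (hx : IsSelfAdjoint x) : (τ x).im = 0 := by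
  have h1 := (Complex.nonneg_iff.1 (hτ.nonneg (x + 1))).2
  have h2 := (Complex.nonneg_iff.1 (hτ.nonneg (x - 1))).2
  rw [star_add, star_one, hx.star_eq] at h1
  rw [star_sub, star_one, hx.star_eq] at h2
  -- Polarization writes `4 x` as a difference of two squares, on which `τ` is real.
  have e : (x + 1) * (x + 1) - (x - 1) * (x - 1) = (4 : ℂ) • x := by
    have : (4 : ℂ) • x = x + x + x + x := by module
    rw [this]
    noncomm_ring
  have h3 := congrArg Complex.im (congrArg τ e)
  rw [map_sub, Complex.sub_im, ← h1, ← h2, map_smul, smul_eq_mul] at h3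
  simpa using h3.symm

open scoped ComplexOrder ContinuousFunctionalCalculus in
/-- Every self-adjoint element has a law. -/
theorem IsNormalFaithfulTracialState.exists_isLawOf (hτ : IsNormalFaithfulTracialState 𝒜 τ)
    {x : 𝒜.toStarSubalgebra} (hx : IsSelfAdjoint x) : ∃ μ : Measure ℝ, IsLawOf τ x μ := by
  -- Norm closedness makes the continuous functional calculus of `x` available inside `𝒜`; the law
  -- is the Riesz measure of `f ↦ τ (f(x))` on the spectrum.
  have : IsClosed (𝒜.toStarSubalgebra : Set (H →L[ℂ] H)) := isClosed_vonNeumannAlgebra 𝒜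
  have hcpt : CompactSpace (spectrum ℝ x) := inferInstance
  let φ : C(spectrum ℝ x, ℝ) →⋆ₐ[ℝ] 𝒜.toStarSubalgebra := cfcHom hx
  let L : C_c(spectrum ℝ x, ℝ) →ₗ[ℝ] ℝ :=
    { toFun := fun f => (τ (φ (f : C(spectrum ℝ x, ℝ)))).re
      map_add' := fun f g => by
        have : ((f + g : C_c(spectrum ℝ x, ℝ)) : C(spectrum ℝ x, ℝ)) = f + g := rfl
        rw [this, map_add, map_add, Complex.add_re]
      map_smul' := fun c f => by
        have : ((c • f : C_c(spectrum ℝ x, ℝ)) : C(spectrum ℝ x, ℝ)) = c • (f : C(_, ℝ)) := rfl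
        rw [this, map_smul, ← Complex.coe_smul, map_smul]
        simp }
  have hL : ∀ f, 0 ≤ f → 0 ≤ L f := by
    intro f hf
    let g : C(spectrum ℝ x, ℝ) := ⟨fun t => √(f t), by fun_prop⟩
    have hg : (f : C(spectrum ℝ x, ℝ)) = g * star g := by
      ext t
      exact (Real.mul_self_sqrt (hf t)).symm
    change 0 ≤ (τ (φ (f : C(spectrum ℝ x, ℝ)))).re
    rw [hg, map_mul, map_star]
    exact (Complex.nonneg_iff.1 (hτ.nonneg _)).1
  let Λ : C_c(spectrum ℝ x, ℝ) →ₚ[ℝ] ℝ := PositiveLinearMap.mk₀ L hL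
  let ν := RealRMK.rieszMeasure Λ
  have hν : ∀ n : ℕ, ∫ t, (t : ℝ) ^ n ∂ν = (τ (x ^ n)).re := by
    intro n
    let f : C_c(spectrum ℝ x, ℝ) :=
      ⟨(ContinuousMap.restrict (spectrum ℝ x) (.id ℝ)) ^ n, HasCompactSupport.of_compactSpace _⟩
    have h1 : ∫ t, f t ∂ν = L f := RealRMK.integral_rieszMeasure Λ f
    have h2 : φ (f : C(spectrum ℝ x, ℝ)) = x ^ n := by
      have : (f : C(spectrum ℝ x, ℝ)) = (ContinuousMap.restrict (spectrum ℝ x) (.id ℝ)) ^ n := rfl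
      rw [this, map_pow, cfcHom_id]
    have h3 : L f = (τ (φ (f : C(spectrum ℝ x, ℝ)))).re := rfl
    rw [h3, h2] at h1
    exact h1
  have hemb : MeasurableEmbedding (Subtype.val : spectrum ℝ x → ℝ) :=
    MeasurableEmbedding.subtype_coe (isCompact_iff_compactSpace.2 hcpt).measurableSet
  refine ⟨ν.map Subtype.val, ⟨⟨?_⟩, spectrum ℝ x, isCompact_iff_compactSpace.2 hcpt, ?_⟩, fun n => ?_⟩
  · have h0 := hν 0
    simp [hτ.map_one] at h0
    rw [hemb.map_apply, Set.preimage_univ]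
    rw [measureReal_def, ENNReal.toReal_eq_one_iff] at h0
    exact h0
  · rw [hemb.map_apply]
    convert measure_empty (μ := ν)
    ext t
    simp
  · rw [hemb.integral_map, hν n]
    exact Complex.ext rfl (by simpa using hτ.im_eq_zero (hx.pow n))

theorem IsLawOf.momentSeries_eq {A : Type*} [Ring A] [Algebra ℂ A] {τ : A →ₗ[ℂ] ℂ} {x : A}
    {μ : Measure ℝ} (h : IsLawOf τ x μ) : momentSeries τ x = measureMomentSeries μ := by
  simp only [momentSeries, measureMomentSeries, h.2]

theorem IsNormalFaithfulTracialState.hasFreeMeixnerLaw_iff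
    (hτ : IsNormalFaithfulTracialState 𝒜 τ) {x : 𝒜.toStarSubalgebra} (hx : IsSelfAdjoint x)
    (a b : ℝ) : HasFreeMeixnerLaw τ x a b ↔ MeixnerEquation a b 1 (momentSeries τ x) := by
  constructor
  · rintro ⟨μ, h1, h2⟩
    rw [h2.momentSeries_eq]
    exact h1.meixnerEquation
  · intro h
    obtain ⟨μ, hμ⟩ := hτ.exists_isLawOf hx
    rw [hμ.momentSeries_eq] at h
    exact ⟨μ, isFreeMeixnerLaw_of_meixnerEquation hμ.1 h, hμ⟩

open PowerSeries in
theorem meixnerEquation_rescale_iff {k : ℂ} (hk : k ≠ 0) (a b c : ℂ) (M : ℂ⟦X⟧) :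
    MeixnerEquation (a * k) b (c * k ^ 2) (rescale k M) ↔ MeixnerEquation a b c M := by
  have hinj : Function.Injective (rescale k : ℂ⟦X⟧ →+* ℂ⟦X⟧) := by
    intro f g h
    have h1 := congrArg (rescale k⁻¹) h
    simpa [rescale_rescale, hk] using h1
  have hX : rescale k (X : ℂ⟦X⟧) = C k * X := by
    ext n
    rw [coeff_rescale, coeff_C_mul, coeff_X]
    split_ifs with h <;> simp [h]
  have hC : ∀ d : ℂ, rescale k (C d : ℂ⟦X⟧) = C d := by
    intro d
    ext n
    rw [coeff_rescale, coeff_C]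
    split_ifs with h <;> simp [h]
  rw [MeixnerEquation, MeixnerEquation]
  refine Iff.trans ?_ (map_eq_zero_iff _ hinj)
  simp only [map_add, map_sub, map_mul, map_pow, hX, hC, map_one, map_ofNat]
  constructor
  · intro h
    linear_combination h
  · intro h
    linear_combination h

/-- The free Meixner law of a rescaled variable, in terms of the `R`-transform of the variable. -/
theorem IsNormalFaithfulTracialState.hasFreeMeixnerLaw_smul_iff
    (hτ : IsNormalFaithfulTracialState 𝒜 τ) {x : 𝒜.toStarSubalgebra} (hx : IsSelfAdjoint x)
    {r : PowerSeries ℂ} (hr : IsRTransform τ x r) {c : ℝ} (hc : 0 < c) (a b : ℝ) :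
    HasFreeMeixnerLaw τ (((√c : ℝ) : ℂ)⁻¹ • x) (a / √c) (b / c) ↔
      r = PowerSeries.C (c : ℂ) * PowerSeries.X ^ 2 + PowerSeries.C (a : ℂ) * PowerSeries.X * r +
        PowerSeries.C ((b : ℂ) / c) * r ^ 2 := by
  have hk : ((√c : ℝ) : ℂ)⁻¹ ≠ 0 := by
    simpa using (Real.sqrt_pos.2 hc).ne'
  have hsa : IsSelfAdjoint (((√c : ℝ) : ℂ)⁻¹ • x) := by
    refine IsSelfAdjoint.smul ?_ hx
    rw [← Complex.ofReal_inv]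
    exact Complex.conj_ofReal _
  have hm : momentSeries τ (((√c : ℝ) : ℂ)⁻¹ • x) =
      PowerSeries.rescale ((√c : ℝ) : ℂ)⁻¹ (momentSeries τ x) := by
    ext n
    simp [momentSeries, smul_pow]
  have h1 : ((a / √c : ℝ) : ℂ) = (a : ℂ) * ((√c : ℝ) : ℂ)⁻¹ := by
    push_cast
    rw [div_eq_mul_inv]
  -- Scaling `x` by `1 / √c` turns variance parameter `c` into 1 and `a` into `a / √c`, and leaves
  -- the third parameter unchanged.
  have h2 : (1 : ℂ) = (c : ℂ) * (((√c : ℝ) : ℂ)⁻¹) ^ 2 := by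
    rw [inv_pow, ← Complex.ofReal_pow, Real.sq_sqrt hc.le, mul_inv_cancel₀]
    exact_mod_cast hc.ne'
  rw [hτ.hasFreeMeixnerLaw_iff hsa, hm, h1, h2, meixnerEquation_rescale_iff hk,
    ← hr.quadratic_iff]
  push_cast
  rfl

end Law

end FreeMeixner

theorem theorem3p2 {H : Type*} [NormedAddCommGroup H] [InnerProductSpace ℂ H] [CompleteSpace H]
    (𝒜 : VonNeumannAlgebra H) (τ : 𝒜.toStarSubalgebra →ₗ[ℂ] ℂ)
    (hτ : FreeMeixner.IsNormalFaithfulTracialState 𝒜 τ)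
    (X Y : 𝒜.toStarSubalgebra) (hX : IsSelfAdjoint X) (hY : IsSelfAdjoint Y)
    (hfree : FreeMeixner.FreelyIndependent τ ![X, Y])
    (hXnd : FreeMeixner.Nondegenerate X) (hYnd : FreeMeixner.Nondegenerate Y)
    (hX0 : τ X = 0) (hY0 : τ Y = 0) (hXY : τ (X ^ 2 + Y ^ 2) = 1)
    (α β a b : ℝ) (hα : 0 < α) (hβ : 0 < β) (hαβ : α + β = 1)
    (hb : -1 ≤ b) (hb' : b < 0 → max (-α) (-β) ≤ b) :
    (FreeMeixner.HasFreeMeixnerLaw τ (((√α : ℝ) : ℂ)⁻¹ • X) (a / √α) (b / α) ∧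
      FreeMeixner.HasFreeMeixnerLaw τ (((√β : ℝ) : ℂ)⁻¹ • Y) (a / √β) (b / β)) ↔
    (FreeMeixner.IsCondExp τ X (X + Y) ((α : ℂ) • (X + Y)) ∧
      FreeMeixner.IsCondExp τ
        (((β : ℂ) • X - (α : ℂ) • Y) * (X + Y) * ((β : ℂ) • X - (α : ℂ) • Y)) (X + Y)
        (((α : ℂ) * (β : ℂ) / ((b : ℂ) + 1) ^ 2) •
          (((b : ℂ) ^ 2) • (X + Y) ^ 3 + (2 * (b : ℂ) * (a : ℂ)) • (X + Y) ^ 2 +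
            ((b : ℂ) + (a : ℂ) ^ 2) • (X + Y) + (a : ℂ) • (1 : 𝒜.toStarSubalgebra)))) := by
  obtain ⟨r, hr⟩ := FreeMeixner.exists_isRTransform τ hτ.map_one X
  obtain ⟨s, hs⟩ := FreeMeixner.exists_isRTransform τ hτ.map_one Y
  -- For negative `b` the bound `b ≥ -α` and `α < 1` exclude `b = -1`, so the division by `(b + 1) ^
  -- 2` is genuine.
  have hb1 : (b : ℂ) + 1 ≠ 0 := by
    have : 0 < b + 1 := by
      rcases lt_or_ge b 0 with h | h
      · have h1 := (max_le_iff.1 (hb' h)).1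
        linarith
      · linarith
    exact_mod_cast this.ne'
  have hα' : (α : ℂ) ≠ 0 := by exact_mod_cast hα.ne'
  have hβ' : (β : ℂ) ≠ 0 := by exact_mod_cast hβ.ne'
  have hαβ' : (α : ℂ) + β = 1 := by exact_mod_cast hαβ
  have hmem : X + Y ∈ (Polynomial.aeval (R := ℂ) (X + Y)).range := ⟨Polynomial.X, by simp⟩
  rw [hτ.hasFreeMeixnerLaw_smul_iff hX hr hα, hτ.hasFreeMeixnerLaw_smul_iff hY hs hβ,
    FreeMeixner.isCondExp_iff_pow hτ (hX.add hY) (Subalgebra.smul_mem _ hmem _),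
    FreeMeixner.isCondExp_iff_pow hτ (hX.add hY)]
  · exact FreeMeixner.regression_iff_quadratic hτ.map_one hτ.trace hfree hX0 hY0 hXY hα' hβ' hαβ'
      hb1 hr hs
  · exact Subalgebra.smul_mem _ (Subalgebra.add_mem _ (Subalgebra.add_mem _ (Subalgebra.add_mem _
      (Subalgebra.smul_mem _ (Subalgebra.pow_mem _ hmem 3) _)
      (Subalgebra.smul_mem _ (Subalgebra.pow_mem _ hmem 2) _)) (Subalgebra.smul_mem _ hmem _))
      (Subalgebra.smul_mem _ (Subalgebra.one_mem _) _)) _
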